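/- Let $G=(V,E)$ be a connected (simple, undirected, non-empty, possibly infinite) graph. The following are equivalent: (i) the space $|G| = G\cup\Omega(G)$ with the topology MTop is metrizable; (ii) the subspace $\hat V(G) = V(G)\cup\Omega(G)$ of $|G|$ is metrizable; (iii) $G$ has a normal spanning tree. Here the *ends* of $G$, which form the set $\Omega(G)$, are the equivalence classes of rays (one-way infinite paths), two rays being equivalent if no finite set of vertices separates them. For a finite $X\subseteq V$ and an end $\omega$, $C(X,\omega)$ denotes the unique component of $G-X$ that contains a tail of every ray in $\omega$, and $\Omega(X,\omega)$ the set of ends $\eta$ with $C(X,\eta)=C(X,\omega)$. The topology MTop on $|G|$ has as a basis all open sets of $G$ considered as a metric length space (every edge with its endvertices is a unit interval, and the distance of two points is the length of a shortest arc between them), together with the sets $C(X,\omega)\cup\Omega(X,\omega)\cup \mathring E_\varepsilon(X,C(X,\omega))$ for finite $X\subseteq V$, $\omega\in\Omega(G)$ and $\varepsilon>0$, where $\mathring E_\varepsilon(X,C(X,\omega))$ is the open ball of radius $\varepsilon$ in $G$ around $C(X,\omega)$. A *normal spanning tree* of $G$ is a rooted spanning tree $T\subseteq G$ with root $r$ such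 that the endvertices of every non-trivial path in $G$ that meets $T$ exactly in its endvertices are comparable in the tree-order of $T$, in which $u\le v$ means that $u$ lies on the path from $r$ to $v$ in $T$. -/

import Mathlib

namespace GraphEnds

universe u

/-! ### Rays and ends -/

/-- A ray in `G`: a one-way infinite path `R 0, R 1, R 2, …`. -/
structure Ray {V : Type u} (G : SimpleGraph V) where
  vert : ℕ → V
  injective : Function.Injective vert
  adj : ∀ n, G.Adj (vert n) (vert (n + 1))

/-- The vertex set `C` contains (all vertices of) a tail of the ray `R`. -/
def Ray.HasTailIn {V : Type u} {G : SimpleGraph V} (R : Ray G) (C : Set V) : Prop :=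
  ∃ N, ∀ n, N ≤ n → R.vert n ∈ C

/-- Two rays are equivalent if no finite set `X` of vertices separates them, that is, for every
finite `X` some walk in `G` from one ray to the other avoids `X`. -/
def RayEquiv {V : Type u} {G : SimpleGraph V} (R S : Ray G) : Prop :=
  ∀ X : Finset V, ∃ (m n : ℕ) (W : G.Walk (R.vert m) (S.vert n)), ∀ x ∈ W.support, x ∉ X

theorem Ray.exists_component {V : Type u} {G : SimpleGraph V} (R : Ray G) (X : Finset V) :
    ∃ C : G.ComponentCompl (X : Set V), R.HasTailIn (C : Set V) := by
  have hfin : (R.vert ⁻¹' (X : Set V)).Finite :=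
    X.finite_toSet.preimage R.injective.injOn
  obtain ⟨N, hN⟩ := hfin.bddAbove
  have hout : ∀ n, N + 1 ≤ n → R.vert n ∉ (X : Set V) := by
    intro n hn hmem
    have := hN (show n ∈ R.vert ⁻¹' (X : Set V) from hmem)
    omega
  refine ⟨G.componentComplMk (hout (N + 1) le_rfl), N + 1, ?_⟩
  intro n hn
  induction n, hn using Nat.le_induction with
  | base => exact G.componentComplMk_mem _
  | succ n hn ih =>
    obtain ⟨h, hC⟩ := ih
    refine ⟨hout (n + 1) (by omega), ?_⟩
    rw [← hC]
    exact (SimpleGraph.componentComplMk_eq_of_adj G _ _ (R.adj n)).symm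

theorem Ray.component_unique {V : Type u} {G : SimpleGraph V} {R : Ray G} {X : Set V}
    {C D : G.ComponentCompl X} (hC : R.HasTailIn (C : Set V)) (hD : R.HasTailIn (D : Set V)) :
    C = D := by
  obtain ⟨M, hM⟩ := hC
  obtain ⟨N, hN⟩ := hD
  obtain ⟨h1, e1⟩ := hM (max M N) (le_max_left _ _)
  obtain ⟨h2, e2⟩ := hN (max M N) (le_max_right _ _)
  exact e1.symm.trans e2

theorem componentComplMk_eq_of_walk {V : Type u} {G : SimpleGraph V} {X : Set V} {a b : V}
    (W : G.Walk a b) (hW : ∀ x ∈ W.support, x ∉ X) (ha : a ∉ X) (hb : b ∉ X) :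
    G.componentComplMk ha = G.componentComplMk hb := by
  induction W with
  | nil => rfl
  | cons h W ih =>
    have hc := hW _ (List.mem_cons_of_mem _ W.start_mem_support)
    exact (SimpleGraph.componentComplMk_eq_of_adj G ha hc h).trans
      (ih (fun x hx => hW x (List.mem_cons_of_mem _ hx)) hc hb)

/-- Two rays are equivalent if and only if, for every finite `X`, they have tails in the same
component of `G - X`. -/
theorem rayEquiv_iff {V : Type u} {G : SimpleGraph V} {R S : Ray G} :
    RayEquiv R S ↔ ∀ X : Finset V, ∃ C : G.ComponentCompl (X : Set V),
      R.HasTailIn (C : Set V) ∧ S.HasTailIn (C : Set V) := by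
  classical
  constructor
  · intro h X
    obtain ⟨C, M, hM⟩ := R.exists_component X
    obtain ⟨D, N, hN⟩ := S.exists_component X
    obtain ⟨m, n, W, hW⟩ := h (X ∪ (Finset.range M).image R.vert ∪ (Finset.range N).image S.vert)
    have hm : M ≤ m := by
      by_contra hlt
      refine hW _ W.start_mem_support ?_
      simp only [Finset.mem_union, Finset.mem_image, Finset.mem_range]
      exact Or.inl (Or.inr ⟨m, by omega, rfl⟩)
    have hn : N ≤ n := by
      by_contra hlt
      refine hW _ W.end_mem_support ?_
      simp only [Finset.mem_union, Finset.mem_image, Finset.mem_range]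
      exact Or.inr ⟨n, by omega, rfl⟩
    obtain ⟨h1, e1⟩ := hM m hm
    obtain ⟨h2, e2⟩ := hN n hn
    have hCD : C = D := by
      rw [← e1, ← e2]
      refine componentComplMk_eq_of_walk W (fun x hx hxX => hW x hx ?_) h1 h2
      simp only [Finset.mem_union]
      exact Or.inl (Or.inl hxX)
    exact ⟨C, ⟨M, hM⟩, hCD ▸ ⟨N, hN⟩⟩
  · intro h X
    obtain ⟨C, ⟨M, hM⟩, ⟨N, hN⟩⟩ := h X
    obtain ⟨h1, e1⟩ := hM M le_rfl
    obtain ⟨h2, e2⟩ := hN N le_rfl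
    obtain ⟨W⟩ := SimpleGraph.ConnectedComponent.exact (e1.trans e2.symm)
    have key : ∀ x ∈ (W.map (SimpleGraph.Embedding.induce _).toHom).support, x ∉ X := by
      intro x hx
      rw [SimpleGraph.Walk.support_map, List.mem_map] at hx
      obtain ⟨y, -, rfl⟩ := hx
      exact fun hX => y.2 hX
    exact ⟨M, N, W.map (SimpleGraph.Embedding.induce _).toHom, key⟩

/-- Equivalence of rays, as an equivalence relation. -/
def raySetoid {V : Type u} (G : SimpleGraph V) : Setoid (Ray G) where
  r := RayEquiv
  iseqv := by
    refine ⟨fun R => rayEquiv_iff.2 fun X => ?_, fun {R S} h => rayEquiv_iff.2 fun X => ?_,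
      fun {R S T} h1 h2 => rayEquiv_iff.2 fun X => ?_⟩
    · obtain ⟨C, hC⟩ := R.exists_component X
      exact ⟨C, hC, hC⟩
    · obtain ⟨C, hC, hC'⟩ := rayEquiv_iff.1 h X
      exact ⟨C, hC', hC⟩
    · obtain ⟨C, hC, hC'⟩ := rayEquiv_iff.1 h1 X
      obtain ⟨D, hD, hD'⟩ := rayEquiv_iff.1 h2 X
      have hCD := Ray.component_unique hC' hD
      exact ⟨C, hC, hCD ▸ hD'⟩

/-- The set `Ω(G)` of ends of `G`: the equivalence classes of rays. -/
def Ends {V : Type u} (G : SimpleGraph V) : Type u := Quotient (raySetoid G)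

/-- The end that a ray belongs to. -/
def Ray.toEnd {V : Type u} {G : SimpleGraph V} (R : Ray G) : Ends G :=
  Quotient.mk (raySetoid G) R

theorem existsUnique_component {V : Type u} {G : SimpleGraph V} (X : Finset V) (ω : Ends G) :
    ∃! C : G.ComponentCompl (X : Set V), ∀ R : Ray G, R.toEnd = ω → R.HasTailIn (C : Set V) := by
  obtain ⟨S, rfl⟩ : ∃ S : Ray G, S.toEnd = ω := Quotient.exists_rep ω
  obtain ⟨C, hC⟩ := S.exists_component X
  refine ⟨C, fun R hR => ?_, fun D hD => Ray.component_unique (hD S rfl) hC⟩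
  obtain ⟨D, hD, hD'⟩ := rayEquiv_iff.1 (Quotient.exact hR : RayEquiv R S) X
  exact Ray.component_unique hD' hC ▸ hD

/-- `C(X, ω)`: the unique component of `G - X` that contains a tail of every ray in `ω`. -/
noncomputable def component {V : Type u} {G : SimpleGraph V} (X : Finset V) (ω : Ends G) :
    G.ComponentCompl (X : Set V) :=
  (existsUnique_component X ω).choose

/-- `Ω(X, ω)`: the set of all ends `η` with `C(X, η) = C(X, ω)`. -/
def endsIn {V : Type u} {G : SimpleGraph V} (X : Finset V) (ω : Ends G) : Set (Ends G) :=
  {η | component X η = component X ω}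

/-! ### The graph as a metric length space -/

open Classical in
/-- The point at distance `t` from `u` on the segment from `u` to `v`, in barycentric
coordinates: `(1 - t) u + t v`. -/
noncomputable def segmentCoord {V : Type u} (u v : V) (t : ℝ) : V → ℝ :=
  (1 - t) • Pi.single u 1 + t • Pi.single v 1

/-- A point of the graph `G` regarded as a 1-complex, given by its barycentric coordinates:
either a vertex, or a point on an edge. -/
structure Point {V : Type u} (G : SimpleGraph V) where
  coord : V → ℝ
  mem_graph : (∃ v, coord = segmentCoord v v 0) ∨
    ∃ u v t, G.Adj u v ∧ t ∈ Set.Icc (0 : ℝ) 1 ∧ coord = segmentCoord u v t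

/-- A vertex of `G` as a point of the 1-complex. -/
noncomputable def Point.ofVertex {V : Type u} (G : SimpleGraph V) (v : V) : Point G :=
  ⟨segmentCoord v v 0, Or.inl ⟨v, rfl⟩⟩

/-- The lengths of routes from `p` to `q` in `G`, every edge being a unit interval: `p` and `q` lie
on a common edge and the route is the part of this edge between them, or the route goes from `p`
straight to an end `u` of its edge, follows a walk from `u` to an end `v` of the edge of `q`, and
then goes straight to `q`. (A vertex is its own and only end here.) Every arc between `p` and `q`
is such a route. -/
def routeLengths {V : Type u} {G : SimpleGraph V} (p q : Point G) : Set ℝ :=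
  {l | ∃ u v s t, G.Adj u v ∧ s ∈ Set.Icc (0 : ℝ) 1 ∧ t ∈ Set.Icc (0 : ℝ) 1 ∧
      p.coord = segmentCoord u v s ∧ q.coord = segmentCoord u v t ∧ l = |s - t|} ∪
  {l | ∃ u v, 0 < p.coord u ∧ 0 < q.coord v ∧
      ∃ W : G.Walk u v, l = (1 - p.coord u) + W.length + (1 - q.coord v)}

/-- The distance between two points of the graph: the length of a shortest arc between them
(infinite if there is none). -/
noncomputable def lengthDist {V : Type u} {G : SimpleGraph V} (p q : Point G) : ENNReal :=
  ⨅ l ∈ routeLengths p q, ENNReal.ofReal l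

/-- Open sets of `G` as a metric length space. -/
def IsMetricOpen {V : Type u} {G : SimpleGraph V} (U : Set (Point G)) : Prop :=
  ∀ p ∈ U, ∃ ε : ℝ, 0 < ε ∧ ∀ q, lengthDist p q < ENNReal.ofReal ε → q ∈ U

/-- The points of the subgraph of `G` induced by the vertex set `C`. -/
def pointsOf {V : Type u} (G : SimpleGraph V) (C : Set V) : Set (Point G) :=
  {p | ∀ v, p.coord v ≠ 0 → v ∈ C}

/-- The open ball of radius `ε` in `G` around a set of points. -/
def ballAround {V : Type u} {G : SimpleGraph V} (A : Set (Point G)) (ε : ℝ) : Set (Point G) :=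
  {q | ∃ p ∈ A, lengthDist p q < ENNReal.ofReal ε}

/-! ### The spaces `|G|` and `V̂(G)` -/

/-- The set `|G| = G ∪ Ω(G)`. -/
inductive ModG {V : Type u} (G : SimpleGraph V) : Type u
  | point (p : Point G)
  | atEnd (ω : Ends G)

/-- The basic open neighbourhood `Ĉ_ε(X, ω)`: the union of `C(X, ω)`, the set `Ω(X, ω)`, and the
open ball of radius `ε` around `C(X, ω)` in `G`. -/
def basicNhd {V : Type u} {G : SimpleGraph V} (X : Finset V) (ω : Ends G) (ε : ℝ) :
    Set (ModG G) :=
  ModG.point '' pointsOf G (component X ω : Set V) ∪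
  ModG.atEnd '' endsIn X ω ∪
  ModG.point '' ballAround (pointsOf G (component X ω : Set V)) ε

/-- The topology MTop on `|G|`, generated by the open sets of the metric length space `G` and the
basic open neighbourhoods `Ĉ_ε(X, ω)` of ends. -/
instance mTop {V : Type u} (G : SimpleGraph V) : TopologicalSpace (ModG G) :=
  TopologicalSpace.generateFrom
    ({A | ∃ U : Set (Point G), IsMetricOpen U ∧ A = ModG.point '' U} ∪
     {A | ∃ (X : Finset V) (ω : Ends G) (ε : ℝ), 0 < ε ∧ A = basicNhd X ω ε})

/-- The subspace `V̂(G) = V(G) ∪ Ω(G)` of `|G|`. -/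
def vHat {V : Type u} (G : SimpleGraph V) : Set (ModG G) :=
  Set.range (fun v => ModG.point (Point.ofVertex G v)) ∪ Set.range ModG.atEnd

/-! ### Normal trees -/

/-- The tree-order of a tree `T` with root `r`: `u ≤ v` if `u` lies on the path from `r` to `v`
in `T`. -/
def TreeLE {V : Type u} {G : SimpleGraph V} (T : G.Subgraph) (r u v : T.verts) : Prop :=
  ∃ P : T.coe.Walk r v, P.IsPath ∧ u ∈ P.support

/-- A path `P` in `G` is an `H`-path if it is non-trivial and meets the subgraph `H` exactly in
its endvertices. -/
def IsHPath {V : Type u} {G : SimpleGraph V} (H : G.Subgraph) {u v : V} (P : G.Walk u v) : Prop :=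
  P.IsPath ∧ ¬ P.Nil ∧ (∀ x ∈ P.support, x ∈ H.verts ↔ x = u ∨ x = v) ∧
    ∀ e ∈ P.edges, e ∉ H.edgeSet

/-- The subgraph `T` of `G`, with root `r`, is a normal tree in `G`: the endvertices of every
`T`-path in `G` are comparable in the tree-order. -/
def IsNormalTree {V : Type u} {G : SimpleGraph V} (T : G.Subgraph) (r : T.verts) : Prop :=
  T.coe.IsTree ∧
    ∀ (u v : T.verts) (P : G.Walk (u : V) (v : V)), IsHPath T P →
      TreeLE T r u v ∨ TreeLE T r v u

/-- `G` has a normal spanning tree. -/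
def HasNormalSpanningTree {V : Type u} (G : SimpleGraph V) : Prop :=
  ∃ (T : G.Subgraph) (r : T.verts), T.IsSpanning ∧ IsNormalTree T r

end GraphEnds

/-!
A normal spanning tree is encoded as a parent map (`ParentMap`), for which adjacent vertices of the
graph are comparable in the tree-order (`ParentMap.IsNormal`); the two descriptions are equivalent.

*A normal spanning tree makes `|G|` metrizable.* Give a point of `|G|` two families of coordinates:
its barycentric coordinates, and for each tree vertex `w` the barycentric weight of the set `up w`
of vertices above `w` (for an end: whether the end lives in `up w`). Scale the coordinates at `w` by
`2⁻ⁿ`, where `n` is the depth of `w`. The resulting map into the bounded functions with the supremum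
norm is an embedding (`isEmbedding_boundedEmbedding`). On the points of `G` both families are
1-Lipschitz, and the barycentric coordinates at the ends of the edge of a point determine its metric
neighbourhoods. At ends the reason is normality: `up w` is a component of the graph minus the
finitely many vertices strictly below `w`, each end lies above exactly one vertex of each depth, and
a finite set `X` is avoided by `up w` for all `w` of large depth.

*If `V̂(G)` is metrizable, there is a normal spanning tree.* Each vertex is isolated in `V̂(G)`, so
it has positive distance from the set of ends. Hence `V` is the union of countably many sets, the
sets of vertices of a given `rank`, each of which can be separated from any end by finitely many
vertices (`exists_dispersed_rank`). It remains to prove Jung's theorem that a connected graph with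
such a ranking has a normal spanning tree (`exists_isNormal_of_rank`). In steps `k = 0, 1, …`,
remove from every component of the remaining graph one vertex `x`, and hang it below the vertex `t`
removed last among those with a neighbour in the component; here `x` is a neighbour of `t` chosen as
close as possible to a vertex of minimal rank in the component (`IsSearch`). The vertex removed in
step `0` is the root. The removed neighbours
of a component always form a chain, so the tree of removed vertices is normal
(`IsSearchTree.le_top`). If some vertex `v` were never removed, then the removed neighbours of its
final component would be infinite in number and lie on a ray of the tree
(`IsSearchTree.exists_ray`). The vertices of minimal rank in the components of `v` have rank at most
that of `v`, so one rank occurs infinitely often; as the search keeps heading for these vertices, the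
ray is joined to vertices of this rank outside any given finite set, contradicting that they can be
separated from the end of the ray (`IsSearchTree.exists_removedAt`).
-/

namespace GraphEnds

universe u
open SimpleGraph

/-! ### Rooted trees given by parent maps -/

/-- A rooted tree on the vertex set `V`, encoded by the map sending each vertex to its parent; the
root is its own parent. -/
structure ParentMap (V : Type u) where
  parent : V → V
  root : V
  depth : V → ℕ
  depth_eq_zero : ∀ v, depth v = 0 ↔ v = root
  depth_parent : ∀ v, v ≠ root → depth (parent v) + 1 = depth v
  parent_root : parent root = root

namespace ParentMap

variable {V : Type u} (P : ParentMap V)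

/-- The tree-order: `u` is obtained from `v` by passing to the parent finitely often. -/
def le (u v : V) : Prop := ∃ i, P.parent^[i] v = u

/-- The up-closure of a vertex in the tree-order. -/
def up (w : V) : Set V := {v | P.le w v}

/-- The parent map describes a normal spanning tree of `G`: the tree edges are edges of `G`, and
adjacent vertices of `G` are comparable. -/
structure IsNormal (G : SimpleGraph V) : Prop where
  adj : ∀ v, v ≠ P.root → G.Adj (P.parent v) v
  comparable : ∀ u v, G.Adj u v → P.le u v ∨ P.le v u

variable {P}

theorem depth_root : P.depth P.root = 0 := (P.depth_eq_zero _).2 rfl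

theorem depth_parent_eq (v : V) : P.depth (P.parent v) = P.depth v - 1 := by
  by_cases h : v = P.root
  · subst h; rw [P.parent_root, depth_root]
  · have := P.depth_parent v h; omega

theorem depth_iterate (i : ℕ) (v : V) : P.depth (P.parent^[i] v) = P.depth v - i := by
  induction i with
  | zero => rfl
  | succ i ih => rw [Function.iterate_succ_apply', depth_parent_eq, ih]; omega

theorem le_refl (v : V) : P.le v v := ⟨0, rfl⟩

theorem le_trans {a b c : V} (h : P.le a b) (h' : P.le b c) : P.le a c := by
  obtain ⟨i, rfl⟩ := h
  obtain ⟨j, rfl⟩ := h'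
  exact ⟨i + j, by rw [Function.iterate_add_apply]⟩

theorem parent_le (v : V) : P.le (P.parent v) v := ⟨1, rfl⟩

theorem depth_le_of_le {a b : V} (h : P.le a b) : P.depth a ≤ P.depth b := by
  obtain ⟨i, rfl⟩ := h
  rw [depth_iterate]; omega

theorem iterate_eq_of_le {a b : V} (h : P.le a b) :
    P.parent^[P.depth b - P.depth a] b = a := by
  obtain ⟨i, hi⟩ := h
  have hd := depth_iterate (P := P) i b
  rw [hi] at hd
  rcases Nat.le_total i (P.depth b) with hle | hle
  · rw [hd, Nat.sub_sub_self hle, hi]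
  · have h1 : a = P.root := (P.depth_eq_zero _).1 (by omega)
    rw [h1, depth_root]
    exact (P.depth_eq_zero _).1 (by rw [depth_iterate]; omega)

theorem eq_of_le_of_depth_le {a b : V} (h : P.le a b) (hd : P.depth b ≤ P.depth a) : a = b := by
  rw [← iterate_eq_of_le h, Nat.sub_eq_zero_of_le hd]; rfl

/-- The vertices below a given vertex form a chain. -/
theorem le_of_le_of_depth_le {a b v : V} (ha : P.le a v) (hb : P.le b v)
    (hd : P.depth a ≤ P.depth b) : P.le a b := by
  have h1 := iterate_eq_of_le ha
  have h2 := iterate_eq_of_le hb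
  have h3 := depth_le_of_le hb
  refine ⟨P.depth b - P.depth a, ?_⟩
  have h4 : P.parent^[P.depth b - P.depth a] (P.parent^[P.depth v - P.depth b] v) = a := by
    rw [← Function.iterate_add_apply,
      show P.depth b - P.depth a + (P.depth v - P.depth b) = P.depth v - P.depth a by omega, h1]
  rwa [h2] at h4

theorem exists_le_depth_eq {v : V} {k : ℕ} (hk : k ≤ P.depth v) : ∃ u, P.le u v ∧ P.depth u = k :=
  ⟨P.parent^[P.depth v - k] v, ⟨_, rfl⟩, by rw [depth_iterate]; omega⟩

theorem root_le (v : V) : P.le P.root v := by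
  obtain ⟨u, hu, h0⟩ := P.exists_le_depth_eq (v := v) (Nat.zero_le _)
  exact (P.depth_eq_zero _).1 h0 ▸ hu

theorem le_parent_of_le_of_ne {a b : V} (h : P.le a b) (hne : a ≠ b) : P.le a (P.parent b) := by
  obtain ⟨i, hi⟩ := h
  cases i with
  | zero => exact absurd hi.symm hne
  | succ i => exact ⟨i, by rwa [Function.iterate_succ_apply] at hi⟩

/-- A parent map is determined by its parents alone, as soon as some rank decreases from each
non-root vertex to its parent. -/
theorem exists_of_rank (parent : V → V) (root : V) (hroot : parent root = root) (rank : V → ℕ)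
    (hrank : ∀ v, v ≠ root → rank (parent v) < rank v) :
    ∃ P : ParentMap V, P.parent = parent ∧ P.root = root := by
  classical
  have hex : ∀ n v, rank v = n → ∃ i, parent^[i] v = root := by
    intro n
    induction n using Nat.strong_induction_on with
    | _ n ih =>
      intro v hv
      by_cases h : v = root
      · exact ⟨0, h⟩
      · obtain ⟨i, hi⟩ := ih _ (hv ▸ hrank v h) (parent v) rfl
        exact ⟨i + 1, hi⟩
  let hex' : ∀ v, ∃ i, parent^[i] v = root := fun v => hex _ v rfl
  refine ⟨⟨parent, root, fun v => Nat.find (hex' v), fun v => Nat.find_eq_zero _, fun v hv => ?_,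
    hroot⟩, rfl, rfl⟩
  exact (Nat.find_comp_succ (hex' v) (hex' (parent v)) hv).symm

/-! ### Parent maps and normal spanning trees -/

/-- The tree described by a parent map, as a graph. -/
def tree (P : ParentMap V) : SimpleGraph V where
  Adj u v := (v ≠ P.root ∧ u = P.parent v) ∨ (u ≠ P.root ∧ v = P.parent u)
  symm := ⟨fun _ _ h => h.symm⟩
  loopless := ⟨fun v h => by
    have h' : v ≠ P.root ∧ v = P.parent v := h.elim id id
    have := P.depth_parent v h'.1
    rw [← h'.2] at this
    omega⟩

theorem tree_adj_parent {v : V} (hv : v ≠ P.root) : P.tree.Adj (P.parent v) v := Or.inl ⟨hv, rfl⟩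

theorem tree_le {G : SimpleGraph V} (h : P.IsNormal G) : P.tree ≤ G := by
  rintro u v (⟨hv, rfl⟩ | ⟨hu, rfl⟩)
  · exact h.adj v hv
  · exact (h.adj u hu).symm

theorem exists_tree_path (v : V) :
    ∃ W : P.tree.Walk P.root v, W.IsPath ∧ ∀ x, x ∈ W.support ↔ P.le x v := by
  generalize hn : P.depth v = n
  induction n generalizing v with
  | zero =>
    obtain rfl := (P.depth_eq_zero _).1 hn
    refine ⟨Walk.nil, Walk.IsPath.nil, fun x => ?_⟩
    rw [Walk.support_nil, List.mem_singleton]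
    refine ⟨fun hx => hx ▸ le_refl _, fun hx => ?_⟩
    exact eq_of_le_of_depth_le hx (by omega)
  | succ n ih =>
    have hv : v ≠ P.root := fun h => by rw [(P.depth_eq_zero v).2 h] at hn; omega
    have hd := P.depth_parent v hv
    obtain ⟨W, hW, hs⟩ := ih (P.parent v) (by omega)
    refine ⟨W.concat (tree_adj_parent hv), hW.concat (fun hmem => ?_) _, fun x => ?_⟩
    · have := depth_le_of_le ((hs v).1 hmem)
      omega
    · rw [Walk.support_concat, List.mem_append, hs, List.mem_singleton]
      constructor
      · rintro (hx | rfl)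
        · exact le_trans hx (parent_le v)
        · exact le_refl _
      · intro hx
        by_cases hxv : x = v
        · exact Or.inr hxv
        · exact Or.inl (le_parent_of_le_of_ne hx hxv)

theorem isTree_tree (P : ParentMap V) : P.tree.IsTree := by
  refine ⟨(connected_iff_exists_forall_reachable _).2
    ⟨P.root, fun v => ⟨(exists_tree_path v).choose⟩⟩, ?_⟩
  -- Deleting the edge from `v` to its parent leaves no edge between `up v` and the rest.
  have key : ∀ v, v ≠ P.root → P.tree.IsBridge s(P.parent v, v) := by
    intro v hv
    rw [isBridge_iff]
    intro hr
    have hd := P.depth_parent v hv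
    obtain ⟨W⟩ := hr.symm
    have : ∀ a b (W : (P.tree.deleteEdges {s(P.parent v, v)}).Walk a b), P.le v a → P.le v b := by
      intro a b W
      induction W with
      | nil => exact id
      | cons h W ih =>
        rename_i x y z
        intro hx
        refine ih ?_
        rw [deleteEdges_adj] at h
        obtain ⟨h1, h2⟩ := h
        rcases h1 with ⟨hy, rfl⟩ | ⟨hx', rfl⟩
        · exact le_trans hx (parent_le y)
        · refine le_parent_of_le_of_ne hx ?_
          rintro rfl
          exact h2 (by rw [Set.mem_singleton_iff, Sym2.eq_swap])
    have := depth_le_of_le (this _ _ W (le_refl v))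
    omega
  rw [isAcyclic_iff_forall_adj_isBridge]
  rintro u v (⟨hv, rfl⟩ | ⟨hu, rfl⟩)
  · exact key v hv
  · rw [Sym2.eq_swap]; exact key u hu

end ParentMap

variable {V : Type u} {G : SimpleGraph V}

theorem ParentMap.IsNormal.hasNormalSpanningTree {P : ParentMap V} (h : P.IsNormal G) :
    HasNormalSpanningTree G := by
  let T : G.Subgraph := SimpleGraph.toSubgraph P.tree (P.tree_le h)
  have hT : T.IsSpanning := SimpleGraph.toSubgraph.isSpanning _ _
  let e : P.tree ≃g T.coe :=
    { toFun := fun v => ⟨v, hT v⟩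
      invFun := fun v => v.1
      left_inv := fun _ => rfl
      right_inv := fun _ => rfl
      map_rel_iff' := Iff.rfl }
  refine ⟨T, ⟨P.root, hT _⟩, hT, e.isTree_iff.1 P.isTree_tree, ?_⟩
  have key : ∀ u v : T.verts, P.le u v → TreeLE T ⟨P.root, hT _⟩ u v := by
    intro u v huv
    obtain ⟨W, hW, hs⟩ := P.exists_tree_path v.1
    refine ⟨W.map e.toHom, hW.map e.injective, ?_⟩
    rw [Walk.support_map]
    exact List.mem_map.2 ⟨u.1, (hs _).2 huv, rfl⟩
  intro u v W hW
  obtain ⟨hp, hnil, hsup, -⟩ := hW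
  -- As the tree is spanning, a path meeting it only in its endvertices is a single edge.
  have hadj : G.Adj u v := by
    have h1 := W.adj_snd hnil
    rcases (hsup _ (W.getVert_mem_support 1)).1 (hT _) with h2 | h2
    · exact absurd h2.symm h1.ne
    · exact h2 ▸ h1
  exact (h.comparable _ _ hadj).imp (key u v) (key v u)

/-- A normal spanning tree yields a parent map: the parent of `v` is the last vertex before `v` on
the tree path from the root. -/
theorem HasNormalSpanningTree.exists_isNormal (h : HasNormalSpanningTree G) :
    ∃ P : ParentMap V, P.IsNormal G := by
  classical
  obtain ⟨T, r, hT, htree, hnorm⟩ := h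
  choose path hpath huniq using fun v : T.verts => htree.existsUnique_path r v
  simp only at huniq
  have hnil : ∀ v, v ≠ r → ¬ (path v).Nil := fun v hv hn => hv hn.eq.symm
  have hdrop : ∀ v, (path v).dropLast = path (path v).penultimate := fun v =>
    huniq _ _ (hpath v).dropLast
  let P : ParentMap V :=
    { parent := fun v => (path ⟨v, hT v⟩).penultimate.1
      root := r.1
      depth := fun v => (path ⟨v, hT v⟩).length
      depth_eq_zero := by
        intro v
        rw [Walk.length_eq_zero_iff]
        refine ⟨fun hn => congrArg Subtype.val hn.eq.symm, ?_⟩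
        rintro rfl
        rw [← huniq r Walk.nil Walk.IsPath.nil]
        exact Walk.Nil.nil
      depth_parent := by
        intro v hv
        have h1 := Walk.length_dropLast_add_one (hnil ⟨v, hT v⟩ (fun h => hv (congrArg Subtype.val h)))
        rw [hdrop] at h1
        exact h1
      parent_root := by
        change (path r).penultimate.1 = r.1
        rw [← huniq r Walk.nil Walk.IsPath.nil]
        rfl }
  have hle : ∀ n (v u : T.verts), (path v).length = n → u ∈ (path v).support → P.le u v := by
    intro n
    induction n with
    | zero =>
      intro v u hn hu
      have hn' := Walk.length_eq_zero_iff.1 hn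
      rw [Walk.nil_iff_support_eq.1 hn', List.mem_singleton] at hu
      rw [hu, hn'.eq]
      exact ParentMap.le_refl _
    | succ n ih =>
      intro v u hn hu
      have hn' : ¬ (path v).Nil := by rw [← Walk.length_eq_zero_iff]; omega
      rw [← Walk.support_dropLast_concat hn', hdrop] at hu
      have hl := Walk.length_dropLast_add_one hn'
      rw [hdrop] at hl
      simp only [List.mem_append, List.mem_singleton] at hu
      rcases hu with hu | rfl
      · exact ParentMap.le_trans (ih _ u (by omega) hu) (P.parent_le v.1)
      · exact ParentMap.le_refl _
  have hTle : ∀ u v : T.verts, TreeLE T r u v → P.le u v := by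
    rintro u v ⟨W, hW, hu⟩
    rw [huniq v W hW] at hu
    exact hle _ v u rfl hu
  refine ⟨P, fun v hv => ?_, fun u v huv => ?_⟩
  · exact T.coe_adj_sub _ _
      (Walk.adj_penultimate (hnil ⟨v, hT v⟩ (fun h => hv (congrArg Subtype.val h))))
  · by_cases hadj : T.Adj u v
    · have hadj' : T.coe.Adj ⟨u, hT u⟩ ⟨v, hT v⟩ := hadj
      by_cases hv : (⟨v, hT v⟩ : T.verts) ∈ (path ⟨u, hT u⟩).support
      · exact Or.inr (hle _ _ _ rfl hv)
      · refine Or.inl (hTle ⟨u, hT u⟩ ⟨v, hT v⟩ ⟨_, (hpath ⟨u, hT u⟩).concat hv hadj', ?_⟩)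
        rw [Walk.support_concat]
        exact List.mem_append_left _ (Walk.end_mem_support _)
    · refine (hnorm ⟨u, hT u⟩ ⟨v, hT v⟩ (Walk.cons huv Walk.nil) ⟨?_, ?_, ?_, ?_⟩).imp
        (hTle ⟨u, hT u⟩ ⟨v, hT v⟩) (hTle ⟨v, hT v⟩ ⟨u, hT u⟩)
      · simpa using huv.ne
      · simp
      · intro x hx
        exact ⟨fun _ => by simpa using hx, fun _ => hT x⟩
      · intro e he
        simp only [Walk.edges_cons, Walk.edges_nil, List.mem_singleton] at he
        rw [he, Subgraph.mem_edgeSet]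
        exact hadj

end GraphEnds

namespace GraphEnds

universe u
open SimpleGraph

/-! ### Barycentric coordinates and routes -/

section Points

variable {V : Type u} {G : SimpleGraph V}

open Classical in
theorem segmentCoord_apply (u v : V) (t : ℝ) (x : V) :
    segmentCoord u v t x = (1 - t) * (if x = u then 1 else 0) + t * (if x = v then 1 else 0) := by
  simp [segmentCoord, Pi.single_apply]

theorem segmentCoord_swap (u v : V) (t : ℝ) : segmentCoord u v t = segmentCoord v u (1 - t) := by
  funext x
  rw [segmentCoord_apply, segmentCoord_apply]
  ring

theorem segmentCoord_self (v : V) (t : ℝ) : segmentCoord v v t = segmentCoord v v 0 := by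
  funext x
  rw [segmentCoord_apply, segmentCoord_apply]
  ring

theorem segmentCoord_zero (u v : V) : segmentCoord u v 0 = segmentCoord u u 0 := by
  funext x
  rw [segmentCoord_apply, segmentCoord_apply]
  ring

theorem segmentCoord_left {u v : V} (h : u ≠ v) (t : ℝ) : segmentCoord u v t u = 1 - t := by
  simp [segmentCoord_apply, h]

theorem segmentCoord_right {u v : V} (h : u ≠ v) (t : ℝ) : segmentCoord u v t v = t := by
  simp [segmentCoord_apply, h.symm]

theorem eq_or_eq_of_segmentCoord_ne_zero {u v x : V} {t : ℝ} (h : segmentCoord u v t x ≠ 0) :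
    x = u ∨ x = v := by
  by_contra! hne
  exact h (by simp [segmentCoord_apply, hne.1, hne.2])

theorem Point.ext_coord {p q : Point G} (h : p.coord = q.coord) : p = q := by
  cases p; cases q; cases h; rfl

/-- Vertices and points on edges, treated uniformly: the segment may be degenerate. -/
theorem Point.exists_segment (p : Point G) : ∃ u v t, (u = v ∨ G.Adj u v) ∧
    t ∈ Set.Icc (0 : ℝ) 1 ∧ p.coord = segmentCoord u v t := by
  rcases p.mem_graph with ⟨v, hv⟩ | ⟨u, v, t, h, ht, hp⟩
  · exact ⟨v, v, 0, Or.inl rfl, by simp, hv⟩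
  · exact ⟨u, v, t, Or.inr h, ht, hp⟩

theorem Point.coord_ofVertex_self (v : V) : (Point.ofVertex G v).coord v = 1 := by
  simp [Point.ofVertex, segmentCoord_apply]

theorem Point.coord_ofVertex_ne {v x : V} (h : x ≠ v) : (Point.ofVertex G v).coord x = 0 := by
  simp [Point.ofVertex, segmentCoord_apply, h]

/-- The total barycentric weight that a point gives to a set of vertices. -/
noncomputable def mass (p : Point G) (B : Set V) : ℝ := ∑ᶠ v, B.indicator p.coord v

theorem mass_segment {p : Point G} {u v : V} {t : ℝ} (h : p.coord = segmentCoord u v t)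
    (B : Set V) : mass p B = (1 - t) * B.indicator 1 u + t * B.indicator 1 v := by
  classical
  have h1 : ∀ a : V, ∀ c : ℝ,
      (fun x => c * B.indicator (1 : V → ℝ) a * (if x = a then 1 else 0)).support ⊆ {a} := by
    intro a c x hx
    by_contra hne
    exact hx (by simp [show x ≠ a from hne])
  have h2 : ∀ a : V, ∀ c : ℝ,
      ∑ᶠ x, c * B.indicator (1 : V → ℝ) a * (if x = a then 1 else 0) = c * B.indicator 1 a := by
    intro a c
    rw [finsum_eq_single _ a (fun x hx => by simp [hx])]
    simp
  rw [mass, ← h2 u, ← h2 v, ← finsum_add_distrib ((Set.finite_singleton u).subset (h1 u _))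
    ((Set.finite_singleton v).subset (h1 v _))]
  refine finsum_congr fun x => ?_
  rw [h]
  by_cases hx : x ∈ B
  · rw [Set.indicator_of_mem hx, segmentCoord_apply]
    congr 1
    · by_cases hu : x = u
      · subst hu; simp [hx]
      · simp [hu]
    · by_cases hu : x = v
      · subst hu; simp [hx]
      · simp [hu]
  · rw [Set.indicator_of_notMem hx]
    by_cases hu : x = u
    · subst hu
      by_cases hv : x = v
      · subst hv; simp [hx]
      · simp [hx, hv]
    · by_cases hv : x = v
      · subst hv; simp [hx, hu]
      · simp [hu, hv]

theorem indicator_one_nonneg (B : Set V) (v : V) : (0 : ℝ) ≤ B.indicator 1 v :=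
  Set.indicator_nonneg (fun _ _ => zero_le_one) _

theorem indicator_one_le_one (B : Set V) (v : V) : B.indicator 1 v ≤ (1 : ℝ) :=
  Set.indicator_le_self' (fun _ _ => zero_le_one) _

theorem mass_mono (p : Point G) {B B' : Set V} (h : B ⊆ B') : mass p B ≤ mass p B' := by
  obtain ⟨u, v, t, -, ht, hp⟩ := p.exists_segment
  rw [mass_segment hp, mass_segment hp]
  have h1 : ∀ a, B.indicator (1 : V → ℝ) a ≤ B'.indicator 1 a :=
    fun a => Set.indicator_le_indicator_of_subset h (fun _ => zero_le_one) a
  exact add_le_add (mul_le_mul_of_nonneg_left (h1 u) (sub_nonneg.2 ht.2))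
    (mul_le_mul_of_nonneg_left (h1 v) ht.1)

theorem mass_compl (p : Point G) (B : Set V) : mass p Bᶜ = 1 - mass p B := by
  classical
  obtain ⟨u, v, t, -, ht, hp⟩ := p.exists_segment
  rw [mass_segment hp, mass_segment hp]
  have h1 : ∀ a, Bᶜ.indicator (1 : V → ℝ) a = 1 - B.indicator 1 a := by
    intro a
    by_cases ha : a ∈ B <;> simp [ha]
  rw [h1, h1]; ring

theorem mass_nonneg (p : Point G) (B : Set V) : 0 ≤ mass p B := by
  obtain ⟨u, v, t, -, ht, hp⟩ := p.exists_segment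
  rw [mass_segment hp]
  have h1 := indicator_one_nonneg B u
  have h2 := indicator_one_nonneg B v
  have := ht.1
  have := sub_nonneg.2 ht.2
  positivity

theorem mass_le_one (p : Point G) (B : Set V) : mass p B ≤ 1 := by
  have := mass_nonneg p Bᶜ
  rw [mass_compl] at this
  linarith

theorem coord_eq_mass (p : Point G) (v : V) : p.coord v = mass p {v} := by
  classical
  obtain ⟨a, b, t, -, ht, hp⟩ := p.exists_segment
  rw [mass_segment hp, hp, segmentCoord_apply]
  simp [Set.indicator_apply, eq_comm]

theorem coord_nonneg (p : Point G) (v : V) : 0 ≤ p.coord v := coord_eq_mass p v ▸ mass_nonneg p _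

theorem coord_le_one (p : Point G) (v : V) : p.coord v ≤ 1 := coord_eq_mass p v ▸ mass_le_one p _

theorem mass_eq_one_of_mem_pointsOf {p : Point G} {B : Set V} (h : p ∈ pointsOf G B) :
    mass p B = 1 := by
  obtain ⟨u, v, t, -, ht, hp⟩ := p.exists_segment
  have h0 : ∀ x, x ∉ B → p.coord x = 0 := fun x hx => by
    by_contra hne
    exact hx (h x hne)
  have hc : mass p Bᶜ = 0 := by
    rw [mass, ← finsum_zero (α := V)]
    refine finsum_congr fun x => ?_
    by_cases hx : x ∈ B
    · simp [hx]
    · simp [hx, h0 x hx]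
  rw [mass_compl] at hc
  linarith

theorem abs_mass_sub_indicator_le (p : Point G) (B : Set V) (u : V) :
    |mass p B - B.indicator 1 u| ≤ 1 - p.coord u := by
  by_cases hu : u ∈ B
  · have h1 := mass_mono p (Set.singleton_subset_iff.2 hu)
    rw [← coord_eq_mass] at h1
    have h2 := mass_le_one p B
    rw [Set.indicator_of_mem hu, Pi.one_apply, abs_le]
    constructor <;> linarith
  · have h1 := mass_mono p (Set.singleton_subset_iff.2 (show u ∈ Bᶜ from hu))
    rw [← coord_eq_mass, mass_compl] at h1
    have h2 := mass_nonneg p B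
    rw [Set.indicator_of_notMem hu, abs_le]
    constructor <;> linarith

/-- The weight of a fixed set of vertices changes at most by the length of a route. -/
theorem abs_mass_sub_le_of_mem_routeLengths {p q : Point G} {l : ℝ} (hl : l ∈ routeLengths p q)
    (B : Set V) : |mass p B - mass q B| ≤ l := by
  rcases hl with ⟨u, v, s, t, -, -, -, hp, hq, rfl⟩ | ⟨u, v, -, -, W, rfl⟩
  · rw [mass_segment hp, mass_segment hq]
    have h1 : |B.indicator (1 : V → ℝ) v - B.indicator 1 u| ≤ 1 := by
      have := indicator_one_nonneg B u
      have := indicator_one_nonneg B v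
      have := indicator_one_le_one B u
      have := indicator_one_le_one B v
      rw [abs_le]; constructor <;> linarith
    calc _ = |(s - t) * (B.indicator (1 : V → ℝ) v - B.indicator 1 u)| := by congr 1; ring
      _ = |s - t| * |B.indicator (1 : V → ℝ) v - B.indicator 1 u| := abs_mul _ _
      _ ≤ |s - t| * 1 := by gcongr
      _ = |s - t| := mul_one _
  · have h1 := abs_le.1 (abs_mass_sub_indicator_le p B u)
    have h2 := abs_le.1 (abs_mass_sub_indicator_le q B v)
    have h3 : |B.indicator (1 : V → ℝ) u - B.indicator 1 v| ≤ W.length := by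
      rcases Nat.eq_zero_or_pos W.length with h0 | h0
      · have huv := Walk.eq_of_length_eq_zero h0
        subst huv
        simp
      · have h4 : (1 : ℝ) ≤ W.length := by exact_mod_cast h0
        have := indicator_one_nonneg B u
        have := indicator_one_nonneg B v
        have := indicator_one_le_one B u
        have := indicator_one_le_one B v
        rw [abs_le]; constructor <;> linarith
    have h3 := abs_le.1 h3
    rw [abs_le]; constructor <;> linarith

theorem lengthDist_lt_iff {p q : Point G} {ε : ℝ} (hε : 0 < ε) :
    lengthDist p q < ENNReal.ofReal ε ↔ ∃ l ∈ routeLengths p q, l < ε := by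
  simp only [lengthDist, iInf_lt_iff, ENNReal.ofReal_lt_ofReal_iff hε, exists_prop]

theorem abs_mass_sub_lt {p q : Point G} {ε : ℝ} (hε : 0 < ε)
    (h : lengthDist p q < ENNReal.ofReal ε) (B : Set V) : |mass p B - mass q B| < ε := by
  obtain ⟨l, hl, hlt⟩ := (lengthDist_lt_iff hε).1 h
  exact (abs_mass_sub_le_of_mem_routeLengths hl B).trans_lt hlt

theorem abs_coord_sub_lt {p q : Point G} {ε : ℝ} (hε : 0 < ε)
    (h : lengthDist p q < ENNReal.ofReal ε) (v : V) : |p.coord v - q.coord v| < ε := by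
  rw [coord_eq_mass, coord_eq_mass]
  exact abs_mass_sub_lt hε h _

theorem lengthDist_lt_of_segment {p q : Point G} {u v : V} {s t ε : ℝ} (hε : 0 < ε)
    (huv : G.Adj u v) (hs : s ∈ Set.Icc (0 : ℝ) 1) (ht : t ∈ Set.Icc (0 : ℝ) 1)
    (hp : p.coord = segmentCoord u v s) (hq : q.coord = segmentCoord u v t) (h : |s - t| < ε) :
    lengthDist p q < ENNReal.ofReal ε :=
  (lengthDist_lt_iff hε).2 ⟨_, Or.inl ⟨u, v, s, t, huv, hs, ht, hp, hq, rfl⟩, h⟩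

theorem lengthDist_self_lt (p : Point G) {ε : ℝ} (hε : 0 < ε) :
    lengthDist p p < ENNReal.ofReal ε := by
  rcases p.mem_graph with ⟨v, hv⟩ | ⟨u, v, t, h, ht, hp⟩
  · have h1 : p.coord v = 1 := by rw [hv, segmentCoord_apply]; simp
    refine (lengthDist_lt_iff hε).2 ⟨_, Or.inr ⟨v, v, ?_, ?_, Walk.nil, rfl⟩, ?_⟩
    · rw [h1]; norm_num
    · rw [h1]; norm_num
    · simp [h1, hε]
  · exact lengthDist_lt_of_segment hε h ht ht hp hp (by simpa)

/-- A route through vertices extends along an edge. -/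
theorem exists_route_extend_of_walk {p₀ p q : Point G} {u v a b : V} {s t : ℝ} (huv : G.Adj u v)
    (ht : t ∈ Set.Icc (0 : ℝ) 1)
    (hp : p.coord = segmentCoord u v s) (hq : q.coord = segmentCoord u v t)
    (ha : 0 < p₀.coord a) (hb : 0 < p.coord b) (W : G.Walk a b) :
    ∃ l ∈ routeLengths p₀ q,
      l ≤ (1 - p₀.coord a) + W.length + (1 - p.coord b) + |s - t| := by
  -- By symmetry the route may be taken to arrive at `p` through `u`.
  wlog hbu : b = u generalizing u v s t
  · have hbv : b = v :=
      (eq_or_eq_of_segmentCoord_ne_zero (hp ▸ hb.ne')).resolve_left hbu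
    have := this huv.symm (s := 1 - s) (t := 1 - t) ⟨by linarith [ht.2], by linarith [ht.1]⟩
      (hp.trans (segmentCoord_swap _ _ _)) (hq.trans (segmentCoord_swap _ _ _)) hbv
    rwa [show (1 - s) - (1 - t) = -(s - t) by ring, abs_neg] at this
  subst hbu
  have hpb : p.coord b = 1 - s := by rw [hp, segmentCoord_left huv.ne]
  have hqb : q.coord b = 1 - t := by rw [hq, segmentCoord_left huv.ne]
  rcases lt_or_eq_of_le ht.2 with h1 | rfl
  · refine ⟨_, Or.inr ⟨a, b, ha, by rw [hqb]; linarith, W, rfl⟩, ?_⟩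
    rw [hpb, hqb]
    linarith [neg_abs_le (s - t)]
  · have hqv : q.coord v = 1 := by rw [hq, segmentCoord_right huv.ne]
    refine ⟨_, Or.inr ⟨a, v, ha, by rw [hqv]; norm_num, W.concat huv, rfl⟩, ?_⟩
    rw [hpb, hqv, Walk.length_concat]
    push_cast
    linarith [neg_abs_le (s - 1)]

/-- A route along an edge into one of its ends can be regarded as a route through vertices. -/
theorem exists_walk_route_of_segment {p₀ p : Point G} {a b : V} {s : ℝ} (hab : G.Adj a b)
    (hs : s ∈ Set.Icc (0 : ℝ) 1) (hp₀ : p₀.coord = segmentCoord a b s)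
    (hp : p.coord = segmentCoord a b 0) :
    ∃ c, 0 < p₀.coord c ∧ 0 < p.coord a ∧ ∃ W : G.Walk c a,
      (1 - p₀.coord c) + W.length + (1 - p.coord a) ≤ |s - 0| := by
  have hpa : p.coord a = 1 := by rw [hp, segmentCoord_left hab.ne]; ring
  rw [hpa, sub_zero, abs_of_nonneg hs.1]
  rcases lt_or_eq_of_le hs.2 with h1 | rfl
  · have ha : p₀.coord a = 1 - s := by rw [hp₀, segmentCoord_left hab.ne]
    refine ⟨a, by rw [ha]; linarith, one_pos, Walk.nil, ?_⟩
    rw [ha, Walk.length_nil]; norm_num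
  · have hb : p₀.coord b = 1 := by rw [hp₀, segmentCoord_right hab.ne]
    refine ⟨b, by rw [hb]; norm_num, one_pos, Walk.cons hab.symm Walk.nil, ?_⟩
    rw [hb]; simp

/-- The triangle inequality for the length distance, for a second step along an edge. -/
theorem exists_route_extend {p₀ p q : Point G} {u v : V} {s t l : ℝ} (huv : G.Adj u v)
    (hs : s ∈ Set.Icc (0 : ℝ) 1) (ht : t ∈ Set.Icc (0 : ℝ) 1)
    (hp : p.coord = segmentCoord u v s) (hq : q.coord = segmentCoord u v t)
    (hl : l ∈ routeLengths p₀ p) : ∃ l' ∈ routeLengths p₀ q, l' ≤ l + |s - t| := by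
  rcases hl with ⟨a, b, s', t', hab, hs', ht', hp₀, hp', rfl⟩ | ⟨a, b, ha, hb, W, rfl⟩
  · rcases eq_or_lt_of_le ht'.1 with rfl | h0
    · obtain ⟨c, hc, ha, W, hW⟩ := exists_walk_route_of_segment hab hs' hp₀ hp'
      obtain ⟨l', h1, h2⟩ := exists_route_extend_of_walk huv ht hp hq hc ha W
      exact ⟨l', h1, by linarith⟩
    rcases eq_or_lt_of_le ht'.2 with rfl | h1
    · obtain ⟨c, hc, ha, W, hW⟩ := exists_walk_route_of_segment hab.symm
        (s := 1 - s') ⟨by linarith [hs'.2], by linarith [hs'.1]⟩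
        (hp₀.trans (segmentCoord_swap _ _ _)) (hp'.trans (by rw [segmentCoord_swap, sub_self]))
      obtain ⟨l', h1, h2⟩ := exists_route_extend_of_walk huv ht hp hq hc ha W
      rw [abs_sub_comm] at hW
      refine ⟨l', h1, ?_⟩
      rw [show s' - 1 = 0 - (1 - s') by ring]
      linarith
    -- Now `p` is an inner point of its edge, so the two edges coincide.
    have hpa : p.coord a = 1 - t' := by rw [hp', segmentCoord_left hab.ne]
    have hpb : p.coord b = t' := by rw [hp', segmentCoord_right hab.ne]
    have hpu : p.coord u = 1 - s := by rw [hp, segmentCoord_left huv.ne]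
    have hpv : p.coord v = s := by rw [hp, segmentCoord_right huv.ne]
    have ha : a = u ∨ a = v := eq_or_eq_of_segmentCoord_ne_zero (t := s) (by
      rw [← hp, hpa]; linarith)
    have hb : b = u ∨ b = v := eq_or_eq_of_segmentCoord_ne_zero (t := s) (by
      rw [← hp, hpb]; linarith)
    rcases ha with rfl | rfl <;> rcases hb with rfl | rfl
    · exact absurd rfl hab.ne
    · obtain rfl : t' = s := hpb.symm.trans hpv
      exact ⟨_, Or.inl ⟨a, b, s', t, hab, hs', ht, hp₀, hq, rfl⟩, abs_sub_le _ _ _⟩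
    · obtain rfl : t' = 1 - s := hpb.symm.trans hpu
      refine ⟨_, Or.inl ⟨a, b, s', 1 - t, hab, hs', ⟨by linarith [ht.2], by linarith [ht.1]⟩, hp₀,
        hq.trans (segmentCoord_swap _ _ _), rfl⟩, ?_⟩
      refine (abs_sub_le _ (1 - s) _).trans (le_of_eq ?_)
      rw [show (1 - s) - (1 - t) = -(s - t) by ring, abs_neg]
    · exact absurd rfl hab.ne
  · exact exists_route_extend_of_walk huv ht hp hq ha hb W

/-- Points whose coordinates are close to those of `p` at the ends of the edge of `p` lie on a
common edge with `p`, close to `p`. -/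
theorem Point.exists_nearby_segment (p : Point G) {ε : ℝ} (hε : 0 < ε) :
    ∃ u v δ, 0 < δ ∧ δ ≤ p.coord u ∧ ∀ q : Point G,
      |q.coord u - p.coord u| < δ → |q.coord v - p.coord v| < δ →
      q = p ∨ ∃ a b s t, G.Adj a b ∧ s ∈ Set.Icc (0 : ℝ) 1 ∧ t ∈ Set.Icc (0 : ℝ) 1 ∧
        p.coord = segmentCoord a b s ∧ q.coord = segmentCoord a b t ∧ |s - t| < ε := by
  have vertex : ∀ v, p.coord = segmentCoord v v 0 →
      ∃ u v δ, 0 < δ ∧ δ ≤ p.coord u ∧ ∀ q : Point G,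
      |q.coord u - p.coord u| < δ → |q.coord v - p.coord v| < δ →
      q = p ∨ ∃ a b s t, G.Adj a b ∧ s ∈ Set.Icc (0 : ℝ) 1 ∧ t ∈ Set.Icc (0 : ℝ) 1 ∧
        p.coord = segmentCoord a b s ∧ q.coord = segmentCoord a b t ∧ |s - t| < ε := by
    intro v hp
    have hpv : p.coord v = 1 := by rw [hp, segmentCoord_apply]; simp
    refine ⟨v, v, min ε 1, by positivity, by rw [hpv]; exact min_le_right _ _,
      fun q hq _ => ?_⟩
    rw [hpv] at hq
    have hq1 := hq.trans_le (min_le_right _ _)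
    have hqε := hq.trans_le (min_le_left _ _)
    have hq0 : q.coord v ≠ 0 := by
      intro h0
      rw [h0] at hq1
      norm_num at hq1
    obtain ⟨a, b, t, hab, ht, hqc⟩ := q.exists_segment
    rcases hab with rfl | hab
    · left
      rw [hqc] at hq0
      obtain rfl := (eq_or_eq_of_segmentCoord_ne_zero hq0).elim id id
      exact Point.ext_coord (hqc.trans ((segmentCoord_self _ _).trans hp.symm))
    · right
      rcases eq_or_eq_of_segmentCoord_ne_zero (hqc ▸ hq0) with rfl | rfl
      · refine ⟨v, b, 0, t, hab, by simp, ht, hp.trans (segmentCoord_zero _ _).symm, hqc, ?_⟩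
        rw [hqc, segmentCoord_left hab.ne] at hqε
        rwa [show (0 : ℝ) - t = 1 - t - 1 by ring]
      · refine ⟨a, v, 1, t, hab, by simp, ht, ?_, hqc, ?_⟩
        · rw [segmentCoord_swap, sub_self, segmentCoord_zero, hp]
        · rw [hqc, segmentCoord_right hab.ne] at hqε
          rwa [abs_sub_comm]
  rcases p.mem_graph with ⟨v, hv⟩ | ⟨u, v, s, huv, hs, hp⟩
  · exact vertex v hv
  rcases eq_or_lt_of_le hs.1 with rfl | h0
  · exact vertex u (hp.trans (segmentCoord_zero _ _))
  rcases eq_or_lt_of_le hs.2 with rfl | h1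
  · exact vertex v (by rw [hp, segmentCoord_swap, sub_self, segmentCoord_zero])
  have hpu : p.coord u = 1 - s := by rw [hp, segmentCoord_left huv.ne]
  have hpv : p.coord v = s := by rw [hp, segmentCoord_right huv.ne]
  refine ⟨u, v, min ε (min s (1 - s)), lt_min hε (lt_min h0 (by linarith)),
    by rw [hpu]; exact (min_le_right _ _).trans (min_le_right _ _), fun q hqu hqv => Or.inr ?_⟩
  rw [hpu] at hqu
  rw [hpv] at hqv
  have hqu0 : q.coord u ≠ 0 := by
    intro h
    rw [h, zero_sub, abs_neg, abs_of_pos (by linarith)] at hqu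
    exact absurd (hqu.trans_le ((min_le_right _ _).trans (min_le_right _ _))) (lt_irrefl _)
  have hqv0 : q.coord v ≠ 0 := by
    intro h
    rw [h, zero_sub, abs_neg, abs_of_pos h0] at hqv
    exact absurd (hqv.trans_le ((min_le_right _ _).trans (min_le_left _ _))) (lt_irrefl _)
  have hqε := hqv.trans_le (min_le_left _ _)
  obtain ⟨a, b, t, hab, ht, hqc⟩ := q.exists_segment
  rcases eq_or_eq_of_segmentCoord_ne_zero (hqc ▸ hqu0) with rfl | rfl <;>
    rcases eq_or_eq_of_segmentCoord_ne_zero (hqc ▸ hqv0) with rfl | rfl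
  · exact absurd rfl huv.ne
  · rw [hqc, segmentCoord_right huv.ne, abs_sub_comm] at hqε
    exact ⟨u, v, s, t, huv, hs, ht, hp, hqc, hqε⟩
  · rw [segmentCoord_swap] at hqc
    rw [hqc, segmentCoord_right huv.ne, abs_sub_comm] at hqε
    exact ⟨u, v, s, 1 - t, huv, hs, ⟨by linarith [ht.2], by linarith [ht.1]⟩, hp, hqc, hqε⟩
  · exact absurd rfl huv.ne

end Points

end GraphEnds

namespace GraphEnds

universe u
open SimpleGraph

/-! ### Ends and up-closures in a normal tree -/

section EndsUp

variable {V : Type u} {G : SimpleGraph V} {P : ParentMap V}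

theorem ParentMap.finite_le (P : ParentMap V) (w : V) : {x | P.le x w}.Finite := by
  refine ((Set.finite_Iic (P.depth w)).image (fun i => P.parent^[i] w)).subset ?_
  intro x hx
  exact ⟨P.depth w - P.depth x, Nat.sub_le _ _, ParentMap.iterate_eq_of_le hx⟩

/-- In a normal tree, the up-closure of `w` can be left along an edge only into the vertices
strictly below `w`. -/
theorem ParentMap.IsNormal.mem_up_of_adj (h : P.IsNormal G) {w a b : V} (ha : a ∈ P.up w)
    (hab : G.Adj a b) (hb : P.le b w → b = w) : b ∈ P.up w := by
  rcases h.comparable a b hab with h1 | h1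
  · exact P.le_trans ha h1
  · rcases Nat.le_total (P.depth w) (P.depth b) with h2 | h2
    · exact P.le_of_le_of_depth_le ha h1 h2
    · exact hb (P.le_of_le_of_depth_le h1 ha h2) ▸ P.le_refl b

theorem ParentMap.IsNormal.component_subset_up (h : P.IsNormal G) {w v : V} {X : Set V}
    (hX : ∀ x, P.le x w → x ≠ w → x ∈ X) (C : G.ComponentCompl X) (hv : v ∈ (C : Set V))
    (hvw : v ∈ P.up w) : (C : Set V) ⊆ P.up w := by
  rintro x ⟨hx, hxC⟩
  obtain ⟨hv', hvC⟩ := hv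
  obtain ⟨W⟩ := ConnectedComponent.exact (hvC.trans hxC.symm)
  have key : ∀ (a b : (Xᶜ : Set V)) (W : (G.induce Xᶜ).Walk a b), a.1 ∈ P.up w → b.1 ∈ P.up w := by
    intro a b W
    induction W with
    | nil => exact id
    | cons hadj W ih =>
      rename_i a b c
      intro ha
      refine ih (h.mem_up_of_adj ha hadj fun hle => ?_)
      by_contra hne
      exact b.2 (hX _ hle hne)
  exact key _ _ W hvw

theorem ParentMap.IsNormal.up_subset_component (h : P.IsNormal G) {w v : V} {X : Set V}
    (hX : ∀ x ∈ P.up w, x ∉ X) (C : G.ComponentCompl X) (hv : v ∈ (C : Set V))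
    (hvw : v ∈ P.up w) : P.up w ⊆ (C : Set V) := by
  have key : ∀ n x (hx : x ∈ P.up w), P.depth x = n →
      G.componentComplMk (hX x hx) = G.componentComplMk (hX w (P.le_refl w)) := by
    intro n
    induction n with
    | zero =>
      intro x hx hn
      obtain rfl : w = x := P.eq_of_le_of_depth_le hx (by omega)
      rfl
    | succ n ih =>
      intro x hx hn
      by_cases hwx : w = x
      · subst hwx; rfl
      · have hroot : x ≠ P.root := fun h0 => by rw [(P.depth_eq_zero x).2 h0] at hn; omega
        have hp : P.parent x ∈ P.up w := P.le_parent_of_le_of_ne hx hwx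
        have := P.depth_parent x hroot
        rw [← ih (P.parent x) hp (by omega)]
        exact componentComplMk_eq_of_adj G _ _ (h.adj x hroot).symm
  intro x hx
  obtain ⟨hv', hvC⟩ := hv
  exact ⟨hX x hx, (key _ x hx rfl).trans ((key _ v hvw rfl).symm.trans hvC)⟩

theorem component_spec {X : Finset V} {ω : Ends G} {R : Ray G} (hR : R.toEnd = ω) :
    R.HasTailIn (component X ω : Set V) :=
  (existsUnique_component X ω).choose_spec.1 R hR

theorem exists_toEnd_eq (ω : Ends G) : ∃ R : Ray G, R.toEnd = ω := Quotient.exists_rep ω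

theorem component_eq_of_hasTailIn {X : Finset V} {ω : Ends G} {R : Ray G} (hR : R.toEnd = ω)
    {C : G.ComponentCompl (X : Set V)} (hC : R.HasTailIn (C : Set V)) : component X ω = C :=
  Ray.component_unique (component_spec hR) hC

theorem exists_component_ne {ω η : Ends G} (h : ω ≠ η) :
    ∃ X : Finset V, component X ω ≠ component X η := by
  by_contra! hall
  obtain ⟨R, rfl⟩ := exists_toEnd_eq ω
  obtain ⟨S, rfl⟩ := exists_toEnd_eq η
  exact h (Quotient.sound (rayEquiv_iff.2 fun X =>
    ⟨component X R.toEnd, component_spec rfl, hall X ▸ component_spec rfl⟩))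

theorem Ray.HasTailIn.mono {R : Ray G} {C D : Set V} (h : R.HasTailIn C) (hCD : C ⊆ D) :
    R.HasTailIn D :=
  h.imp fun _ hN n hn => hCD (hN n hn)

theorem Ray.HasTailIn.exists_mem {R : Ray G} {C D : Set V} (hC : R.HasTailIn C)
    (hD : R.HasTailIn D) : ∃ v, v ∈ C ∧ v ∈ D := by
  obtain ⟨M, hM⟩ := hC
  obtain ⟨N, hN⟩ := hD
  exact ⟨_, hM _ (le_max_left M N), hN _ (le_max_right M N)⟩

/-- The end `ω` lies above the vertex `w`: some ray of `ω` has a tail in the up-closure of `w`. -/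
def EndAbove (P : ParentMap V) (ω : Ends G) (w : V) : Prop :=
  ∃ R : Ray G, R.toEnd = ω ∧ R.HasTailIn (P.up w)

theorem EndAbove.component_subset_up (h : P.IsNormal G) {ω : Ends G} {w : V}
    (hω : EndAbove P ω w) {X : Finset V} (hX : ∀ x, P.le x w → x ≠ w → x ∈ X) :
    (component X ω : Set V) ⊆ P.up w := by
  obtain ⟨R, hR, hw⟩ := hω
  obtain ⟨v, hv, hv'⟩ := (component_spec (X := X) hR).exists_mem hw
  exact h.component_subset_up hX _ hv hv'

theorem EndAbove.up_subset_component (h : P.IsNormal G) {ω : Ends G} {w : V}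
    (hω : EndAbove P ω w) {X : Finset V} (hX : ∀ x ∈ P.up w, x ∉ X) :
    P.up w ⊆ (component X ω : Set V) := by
  obtain ⟨R, hR, hw⟩ := hω
  obtain ⟨v, hv, hv'⟩ := (component_spec (X := X) hR).exists_mem hw
  exact h.up_subset_component hX _ hv hv'

theorem endAbove_of_component_subset_up {ω : Ends G} {w : V} {X : Finset V}
    (hX : (component X ω : Set V) ⊆ P.up w) : EndAbove P ω w := by
  obtain ⟨R, hR⟩ := exists_toEnd_eq ω
  exact ⟨R, hR, (component_spec hR).mono hX⟩

theorem EndAbove.hasTailIn (h : P.IsNormal G) {ω : Ends G} {w : V}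
    (hω : EndAbove P ω w) {R : Ray G} (hR : R.toEnd = ω) : R.HasTailIn (P.up w) := by
  classical
  refine (component_spec (X := (P.finite_le w).toFinset.erase w) hR).mono
    (hω.component_subset_up h fun x hx hne => ?_)
  simpa using ⟨hne, hx⟩

/-- The vertices below an end form a chain containing a vertex of every depth: the normal ray of
that end. -/
theorem exists_endAbove_depth_eq (h : P.IsNormal G) (ω : Ends G) (k : ℕ) :
    ∃ w, P.depth w = k ∧ EndAbove P ω w := by
  obtain ⟨R, hR⟩ := exists_toEnd_eq ω
  induction k with
  | zero => exact ⟨P.root, P.depth_root, R, hR, 0, fun n _ => P.root_le _⟩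
  | succ k ih =>
    obtain ⟨w, hw, hω⟩ := ih
    obtain ⟨N, hN⟩ := hω.hasTailIn h hR
    obtain ⟨M, hM⟩ := ((Set.finite_singleton w).preimage R.injective.injOn).bddAbove
    have hne : ∀ n, M + 1 ≤ n → w ≠ R.vert n := by
      intro n hn heq
      have := hM (show n ∈ R.vert ⁻¹' {w} from heq.symm)
      omega
    have hd : ∀ n, max N (M + 1) ≤ n → k + 1 ≤ P.depth (R.vert n) := by
      intro n hn
      by_contra hlt
      exact hne n (le_trans (le_max_right _ _) hn)
        (P.eq_of_le_of_depth_le (hN n (le_trans (le_max_left _ _) hn)) (by omega))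
    obtain ⟨z, hz, hzd⟩ := P.exists_le_depth_eq (hd _ le_rfl)
    refine ⟨z, hzd, R, hR, max N (M + 1), fun n hn => ?_⟩
    induction n, hn using Nat.le_induction with
    | base => exact hz
    | succ n hn ih =>
      refine h.mem_up_of_adj ih (R.adj n) fun hle => P.eq_of_le_of_depth_le hle ?_
      rw [hzd]
      exact hd _ (by omega)

theorem EndAbove.iff_le (h : P.IsNormal G) {ω : Ends G} {w w' : V} (hω : EndAbove P ω w)
    (hd : P.depth w' ≤ P.depth w) : EndAbove P ω w' ↔ P.le w' w := by
  obtain ⟨R, hR, hw⟩ := hω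
  constructor
  · intro h'
    obtain ⟨v, hv, hv'⟩ := (h'.hasTailIn h hR).exists_mem hw
    exact P.le_of_le_of_depth_le hv hv' hd
  · intro hle
    exact ⟨R, hR, hw.mono fun v hv => P.le_trans hle hv⟩

/-- For every end and every finite set `X` there is a vertex below the end whose up-closure
avoids `X`. -/
theorem exists_endAbove_disjoint (h : P.IsNormal G) (ω : Ends G) (X : Finset V) :
    ∃ w, EndAbove P ω w ∧ ∀ x ∈ P.up w, x ∉ X := by
  obtain ⟨w, hw, hω⟩ := exists_endAbove_depth_eq h ω (X.sup P.depth + 1)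
  refine ⟨w, hω, fun x hx hxX => ?_⟩
  have h1 := P.depth_le_of_le hx
  have h2 := Finset.le_sup (f := P.depth) hxX
  omega

end EndsUp

end GraphEnds

namespace GraphEnds

universe u

/-! ### Metrizability from a normal spanning tree -/

section Metrizable

variable {V : Type u} {G : SimpleGraph V}

/-- The barycentric coordinates on `|G|`; those of an end are zero. -/
def ModG.coord : ModG G → V → ℝ
  | ModG.point p, v => p.coord v
  | ModG.atEnd _, _ => 0

open Classical in
/-- The weight of the up-closure of `w` in the barycentric coordinates of a point; an end has
weight `1` if it lies above `w`, and `0` otherwise. -/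
noncomputable def upWeight (P : ParentMap V) : ModG G → V → ℝ
  | ModG.point p, w => mass p (P.up w)
  | ModG.atEnd ω, w => if EndAbove P ω w then 1 else 0

/-- The coordinates of the embedding of `|G|` into a space of bounded functions: the weights of
up-closures and the barycentric coordinates, both scaled by `2⁻ⁿ` at tree vertices of depth `n`. -/
noncomputable def feature (P : ParentMap V) (x : ModG G) : V ⊕ V → ℝ
  | Sum.inl w => (1 / 2) ^ P.depth w * upWeight P x w
  | Sum.inr v => (1 / 2) ^ P.depth v * x.coord v

theorem ModG.coord_nonneg (x : ModG G) (v : V) : 0 ≤ x.coord v := by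
  cases x with
  | point p => exact GraphEnds.coord_nonneg p v
  | atEnd ω => exact le_rfl

theorem ModG.coord_le_one (x : ModG G) (v : V) : x.coord v ≤ 1 := by
  cases x with
  | point p => exact GraphEnds.coord_le_one p v
  | atEnd ω => exact zero_le_one

theorem upWeight_nonneg (P : ParentMap V) (x : ModG G) (w : V) : 0 ≤ upWeight P x w := by
  cases x with
  | point p => exact mass_nonneg _ _
  | atEnd ω => simp only [upWeight]; split_ifs <;> norm_num

theorem upWeight_le_one (P : ParentMap V) (x : ModG G) (w : V) : upWeight P x w ≤ 1 := by
  cases x with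
  | point p => exact mass_le_one _ _
  | atEnd ω => simp only [upWeight]; split_ifs <;> norm_num

theorem half_pow_pos (n : ℕ) : (0 : ℝ) < (1 / 2) ^ n := by positivity

theorem half_pow_le_one (n : ℕ) : ((1 : ℝ) / 2) ^ n ≤ 1 :=
  pow_le_one₀ (by norm_num) (by norm_num)

theorem abs_feature_le_one (P : ParentMap V) (x : ModG G) (i : V ⊕ V) : |feature P x i| ≤ 1 := by
  rcases i with w | v
  · rw [feature, abs_of_nonneg (mul_nonneg (half_pow_pos _).le (upWeight_nonneg _ _ _))]
    exact mul_le_one₀ (half_pow_le_one _) (upWeight_nonneg _ _ _) (upWeight_le_one _ _ _)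
  · rw [feature, abs_of_nonneg (mul_nonneg (half_pow_pos _).le (x.coord_nonneg _))]
    exact mul_le_one₀ (half_pow_le_one _) (x.coord_nonneg _) (x.coord_le_one _)

/-- The map from `|G|` to the bounded functions on `V ⊕ V` that induces the topology of `|G|` if
`P` is a normal spanning tree. -/
noncomputable def boundedEmbedding (P : ParentMap V) (x : ModG G) :
    lp (fun _ : V ⊕ V => ℝ) ⊤ :=
  ⟨feature P x, memℓp_infty ⟨1, by rintro _ ⟨i, rfl⟩; exact abs_feature_le_one P x i⟩⟩

theorem dist_boundedEmbedding_le {P : ParentMap V} {x y : ModG G} {c : ℝ} (hc : 0 ≤ c)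
    (h : ∀ i, |feature P x i - feature P y i| ≤ c) :
    dist (boundedEmbedding P x) (boundedEmbedding P y) ≤ c := by
  rw [dist_eq_norm]
  exact lp.norm_le_of_forall_le hc h

theorem abs_feature_sub_le_dist (P : ParentMap V) (x y : ModG G) (i : V ⊕ V) :
    |feature P x i - feature P y i| ≤ dist (boundedEmbedding P x) (boundedEmbedding P y) := by
  rw [dist_eq_norm]
  exact lp.norm_apply_le_norm (by simp) (boundedEmbedding P x - boundedEmbedding P y) i

theorem abs_half_pow_mul_sub_le {n : ℕ} {a b c : ℝ} (h : |a - b| ≤ c) :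
    |(1 / 2) ^ n * a - (1 / 2) ^ n * b| ≤ c := by
  rw [← mul_sub, abs_mul, abs_of_pos (half_pow_pos n)]
  exact (mul_le_of_le_one_left (abs_nonneg _) (half_pow_le_one n)).trans h

theorem abs_half_pow_mul_sub_le_of_le {m n : ℕ} {a b : ℝ} (hn : n ≤ m) (ha : 0 ≤ a) (ha' : a ≤ 1)
    (hb : 0 ≤ b) (hb' : b ≤ 1) : |(1 / 2) ^ m * a - (1 / 2) ^ m * b| ≤ (1 / 2) ^ n := by
  rw [← mul_sub, abs_mul, abs_of_pos (half_pow_pos m)]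
  have h1 : |a - b| ≤ 1 := by rw [abs_le]; constructor <;> linarith
  calc ((1 : ℝ) / 2) ^ m * |a - b| ≤ (1 / 2) ^ m * 1 := by gcongr
    _ = (1 / 2) ^ m := mul_one _
    _ ≤ (1 / 2) ^ n := pow_le_pow_of_le_one (by norm_num) (by norm_num) hn

theorem abs_sub_lt_of_half_pow_mul {n : ℕ} {a b δ : ℝ}
    (h : |(1 / 2) ^ n * a - (1 / 2) ^ n * b| < (1 / 2) ^ n * δ) : |a - b| < δ := by
  rw [← mul_sub, abs_mul, abs_of_pos (half_pow_pos n)] at h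
  exact lt_of_mul_lt_mul_left h (half_pow_pos n).le

theorem dist_boundedEmbedding_point_le (P : ParentMap V) {p q : Point G} {ε : ℝ} (hε : 0 < ε)
    (h : lengthDist p q < ENNReal.ofReal ε) :
    dist (boundedEmbedding P (ModG.point p)) (boundedEmbedding P (ModG.point q)) ≤ ε := by
  refine dist_boundedEmbedding_le hε.le ?_
  rintro (w | v)
  · exact abs_half_pow_mul_sub_le (abs_mass_sub_lt hε h _).le
  · exact abs_half_pow_mul_sub_le (abs_coord_sub_lt hε h _).le

theorem continuousAt_boundedEmbedding_point (P : ParentMap V) (p : Point G) :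
    ContinuousAt (boundedEmbedding P) (ModG.point p) := by
  rw [ContinuousAt, Metric.tendsto_nhds]
  intro ε hε
  let U : Set (Point G) := {q | dist (boundedEmbedding P (ModG.point q))
    (boundedEmbedding P (ModG.point p)) < ε}
  have hU : IsMetricOpen U := by
    intro q hq
    have hq' : 0 < ε - dist (boundedEmbedding P (ModG.point q))
      (boundedEmbedding P (ModG.point p)) := sub_pos.2 hq
    refine ⟨_, half_pos hq', fun q' hqq' => ?_⟩
    have h1 := dist_boundedEmbedding_point_le P (half_pos hq') hqq'
    have h2 := dist_triangle_left (boundedEmbedding P (ModG.point q'))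
      (boundedEmbedding P (ModG.point p)) (boundedEmbedding P (ModG.point q))
    change dist _ _ < ε
    linarith
  have hopen : IsOpen (ModG.point '' U) :=
    TopologicalSpace.isOpen_generateFrom_of_mem (Or.inl ⟨U, hU, rfl⟩)
  refine Filter.mem_of_superset (hopen.mem_nhds ⟨p, ?_, rfl⟩) ?_
  · change dist _ _ < ε
    rwa [dist_self]
  · rintro _ ⟨q, hq, rfl⟩
    exact hq

theorem mem_basicNhd_atEnd {X : Finset V} {ω η : Ends G} {ε : ℝ} :
    ModG.atEnd η ∈ basicNhd X ω ε ↔ component X η = component X ω := by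
  simp [basicNhd, endsIn]

theorem mem_basicNhd_point {X : Finset V} {ω : Ends G} {ε : ℝ} (hε : 0 < ε) {q : Point G} :
    ModG.point q ∈ basicNhd X ω ε ↔
      ∃ p ∈ pointsOf G (component X ω : Set V), lengthDist p q < ENNReal.ofReal ε := by
  simp only [basicNhd, ballAround, Set.mem_union, Set.mem_image, ModG.point.injEq, exists_eq_right,
    reduceCtorEq, and_false, exists_false, or_false, Set.mem_ofPred_eq]
  exact ⟨fun h => h.elim (fun h => ⟨q, h, lengthDist_self_lt q hε⟩) id, Or.inr⟩

theorem basicNhd_mem_nhds (X : Finset V) (ω : Ends G) {ε : ℝ} (hε : 0 < ε) :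
    basicNhd X ω ε ∈ nhds (ModG.atEnd ω) :=
  IsOpen.mem_nhds (TopologicalSpace.isOpen_generateFrom_of_mem (Or.inr ⟨X, ω, ε, hε, rfl⟩))
    (mem_basicNhd_atEnd.2 rfl)

theorem pointsOf_mono {B B' : Set V} (h : B ⊆ B') : pointsOf G B ⊆ pointsOf G B' :=
  fun _ hp v hv => h (hp v hv)

variable {P : ParentMap V}

/-- Near an end `ω`, the vertex `w` of depth `n` below `ω` separates: the component of the graph
minus the vertices strictly below `w` in which `ω` lives is contained in `up w`, so that nothing
there differs from `ω` in coordinates belonging to depth less than `n`. -/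
theorem continuousAt_boundedEmbedding_atEnd (h : P.IsNormal G) (ω : Ends G) :
    ContinuousAt (boundedEmbedding P) (ModG.atEnd ω) := by
  classical
  rw [ContinuousAt, Metric.tendsto_nhds]
  intro ε hε
  have hε' : 0 < ε / 2 := half_pos hε
  obtain ⟨n, hn⟩ := exists_pow_lt_of_lt_one hε' (show (1 / 2 : ℝ) < 1 by norm_num)
  obtain ⟨w, hw, hω⟩ := exists_endAbove_depth_eq h ω n
  have hC : (component ((P.finite_le w).toFinset.erase w) ω : Set V) ⊆ P.up w :=
    hω.component_subset_up h fun x hx hne => by simpa using ⟨hne, hx⟩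
  refine Filter.mem_of_superset (basicNhd_mem_nhds ((P.finite_le w).toFinset.erase w) ω hε') ?_
  intro y hy
  refine lt_of_le_of_lt (dist_boundedEmbedding_le hε'.le ?_) (half_lt_self hε)
  rintro (w' | v)
  · rcases Nat.lt_or_ge n (P.depth w') with hd | hd
    · exact (abs_half_pow_mul_sub_le_of_le hd.le (upWeight_nonneg _ _ _) (upWeight_le_one _ _ _)
        (upWeight_nonneg _ _ _) (upWeight_le_one _ _ _)).trans hn.le
    · refine abs_half_pow_mul_sub_le ?_
      rw [← hw] at hd
      cases y with
      | atEnd η =>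
        rw [mem_basicNhd_atEnd] at hy
        have hη : EndAbove P η w := endAbove_of_component_subset_up (hy ▸ hC)
        simp only [upWeight, hη.iff_le h hd, hω.iff_le h hd, sub_self, abs_zero]
        exact hε'.le
      | point q =>
        obtain ⟨p, hp, hpq⟩ := (mem_basicNhd_point hε').1 hy
        have hmass : mass p (P.up w') = if P.le w' w then 1 else 0 := by
          split_ifs with hle
          · exact mass_eq_one_of_mem_pointsOf
              (pointsOf_mono (hC.trans fun v hv => P.le_trans hle hv) hp)
          · have h1 : mass p (P.up w')ᶜ = 1 := mass_eq_one_of_mem_pointsOf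
              (pointsOf_mono (hC.trans fun v hv hv' => hle (P.le_of_le_of_depth_le hv' hv hd)) hp)
            rw [mass_compl] at h1
            linarith
        simp only [upWeight, hω.iff_le h hd]
        rw [← hmass, abs_sub_comm]
        exact (abs_mass_sub_lt hε' hpq _).le
  · rcases Nat.lt_or_ge (P.depth v) n with hd | hd
    · refine abs_half_pow_mul_sub_le ?_
      cases y with
      | atEnd η => simpa [ModG.coord] using hε'.le
      | point q =>
        obtain ⟨p, hp, hpq⟩ := (mem_basicNhd_point hε').1 hy
        have hpv : p.coord v = 0 := by
          by_contra hne
          have := P.depth_le_of_le (hC (hp v hne))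
          omega
        have := abs_coord_sub_lt hε' hpq v
        rw [hpv, abs_sub_comm] at this
        exact this.le
    · exact (abs_half_pow_mul_sub_le_of_le hd (y.coord_nonneg _) (y.coord_le_one _)
        (ModG.coord_nonneg _ _) (ModG.coord_le_one _ _)).trans hn.le

/-- Whatever is mapped close to the image of a point `p` is a point on a common edge with `p`. -/
theorem exists_nearby_of_dist_lt (P : ParentMap V) (p : Point G) {ε : ℝ} (hε : 0 < ε) :
    ∃ δ > 0, ∀ y, dist (boundedEmbedding P y) (boundedEmbedding P (ModG.point p)) < δ →
      ∃ q, y = ModG.point q ∧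
      (q = p ∨ ∃ a b s t, G.Adj a b ∧ s ∈ Set.Icc (0 : ℝ) 1 ∧ t ∈ Set.Icc (0 : ℝ) 1 ∧
        p.coord = segmentCoord a b s ∧ q.coord = segmentCoord a b t ∧ |s - t| < ε) := by
  obtain ⟨u, v, δ, hδ, hδu, hnear⟩ := p.exists_nearby_segment hε
  refine ⟨min ((1 / 2) ^ P.depth u * δ) ((1 / 2) ^ P.depth v * δ),
    lt_min (mul_pos (half_pow_pos _) hδ) (mul_pos (half_pow_pos _) hδ), fun y hy => ?_⟩
  have hu : |y.coord u - p.coord u| < δ := abs_sub_lt_of_half_pow_mul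
    ((abs_feature_sub_le_dist P y (ModG.point p) (Sum.inr u)).trans_lt
      (hy.trans_le (min_le_left _ _)))
  have hv : |y.coord v - p.coord v| < δ := abs_sub_lt_of_half_pow_mul
    ((abs_feature_sub_le_dist P y (ModG.point p) (Sum.inr v)).trans_lt
      (hy.trans_le (min_le_right _ _)))
  cases y with
  | point q => exact ⟨q, rfl, hnear q hu hv⟩
  | atEnd ω =>
    simp only [ModG.coord, zero_sub, abs_neg] at hu
    exact absurd (hu.trans_le hδu) (not_lt.2 (le_abs_self _))

/-- Whatever is mapped close to the image of an end `ω` lies in a prescribed basic neighbourhood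
of `ω`. -/
theorem exists_mem_basicNhd_of_dist_lt (h : P.IsNormal G) (X : Finset V) (ω : Ends G) {ε : ℝ}
    (hε : 0 < ε) : ∃ δ > 0, ∀ y,
      dist (boundedEmbedding P y) (boundedEmbedding P (ModG.atEnd ω)) < δ → y ∈ basicNhd X ω ε := by
  obtain ⟨w, hω, hX⟩ := exists_endAbove_disjoint h ω X
  have hC := hω.up_subset_component h hX
  refine ⟨(1 / 2) ^ P.depth w * min ε 1, by positivity, fun y hy => ?_⟩
  have hw : |upWeight P y w - upWeight P (ModG.atEnd ω) w| < min ε 1 := abs_sub_lt_of_half_pow_mul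
    ((abs_feature_sub_le_dist P y (ModG.atEnd ω) (Sum.inl w)).trans_lt hy)
  have h1 : upWeight P (ModG.atEnd ω) w = 1 := if_pos hω
  rw [h1] at hw
  have hwε := (abs_lt.1 (hw.trans_le (min_le_left _ _))).1
  have hw1 := (abs_lt.1 (hw.trans_le (min_le_right _ _))).1
  have hpos : 0 < upWeight P y w := by linarith
  cases y with
  | atEnd η =>
    rw [mem_basicNhd_atEnd]
    have hη : EndAbove P η w := by
      by_contra hne
      simp [upWeight, hne] at hpos
    obtain ⟨R, hR, hRw⟩ := hη
    exact component_eq_of_hasTailIn hR (hRw.mono hC)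
  | point q =>
    rw [mem_basicNhd_point hε]
    change 0 < mass q (P.up w) at hpos
    change -ε < mass q (P.up w) - 1 at hwε
    -- The ends of the edge of `q` that lie in `up w` carry weight greater than `1 - ε`.
    have edge : ∀ u v t, G.Adj u v → t ∈ Set.Icc (0 : ℝ) 1 → q.coord = segmentCoord u v t →
        v ∈ P.up w →
        ∃ p ∈ pointsOf G (component X ω : Set V), lengthDist p q < ENNReal.ofReal ε := by
      intro u v t huv ht hq hv
      by_cases hu : u ∈ P.up w
      · refine ⟨q, fun x hx => hC ?_, lengthDist_self_lt q hε⟩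
        rcases eq_or_eq_of_segmentCoord_ne_zero (hq ▸ hx) with rfl | rfl
        · exact hu
        · exact hv
      · rw [mass_segment hq, Set.indicator_of_notMem hu, Set.indicator_of_mem hv,
          Pi.one_apply] at hwε
        refine ⟨⟨segmentCoord u v 1, Or.inr ⟨u, v, 1, huv, by simp, rfl⟩⟩, fun x hx => hC ?_,
          lengthDist_lt_of_segment hε huv (s := 1) (by simp) ht rfl hq ?_⟩
        · rcases eq_or_eq_of_segmentCoord_ne_zero hx with rfl | rfl
          · exact absurd (by simp [segmentCoord_left huv.ne]) hx
          · exact hv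
        · rw [abs_of_nonneg (by linarith [ht.2])]
          linarith
    obtain ⟨u, v, t, huv, ht, hq⟩ := q.exists_segment
    have hone : u ∈ P.up w ∨ v ∈ P.up w := by
      by_contra! hne
      rw [mass_segment hq, Set.indicator_of_notMem hne.1, Set.indicator_of_notMem hne.2] at hpos
      simp at hpos
    rcases huv with rfl | huv
    · refine ⟨q, fun x hx => hC ?_, lengthDist_self_lt q hε⟩
      rw [hq] at hx
      rcases eq_or_eq_of_segmentCoord_ne_zero hx with rfl | rfl
      · exact hone.elim id id
      · exact hone.elim id id
    · rcases hone with hu | hv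
      · exact edge v u (1 - t) huv.symm ⟨by linarith [ht.2], by linarith [ht.1]⟩
          (hq.trans (segmentCoord_swap _ _ _)) hu
      · exact edge u v t huv ht hq hv

theorem boundedEmbedding_injective (h : P.IsNormal G) :
    Function.Injective (boundedEmbedding P : ModG G → _) := by
  have hpoint : ∀ (p : Point G) (y : ModG G),
      boundedEmbedding P y = boundedEmbedding P (ModG.point p) → y = ModG.point p := by
    intro p y hy
    have hd : dist (boundedEmbedding P y) (boundedEmbedding P (ModG.point p)) = 0 := by
      rw [hy, dist_self]
    obtain ⟨δ, hδ, hδ'⟩ := exists_nearby_of_dist_lt P p one_pos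
    obtain ⟨q, rfl, -⟩ := hδ' y (hd ▸ hδ)
    congr 1
    refine Point.ext_coord (funext fun v => ?_)
    have := abs_feature_sub_le_dist P (ModG.point q) (ModG.point p) (Sum.inr v)
    rw [hd] at this
    have := sub_eq_zero.1 (abs_nonpos_iff.1 this)
    exact mul_left_cancel₀ (half_pow_pos _).ne' this
  intro x y hxy
  cases y with
  | point p => exact hpoint p x hxy
  | atEnd η =>
    cases x with
    | point q => exact (hpoint q _ hxy.symm).symm
    | atEnd ω =>
      by_contra hne
      obtain ⟨X, hX⟩ := exists_component_ne fun h0 : ω = η => hne (congrArg ModG.atEnd h0)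
      obtain ⟨δ, hδ, hδ'⟩ := exists_mem_basicNhd_of_dist_lt h X η one_pos
      exact hX (mem_basicNhd_atEnd.1 (hδ' (ModG.atEnd ω) (by rw [hxy, dist_self]; exact hδ)))

theorem isEmbedding_boundedEmbedding (h : P.IsNormal G) :
    Topology.IsEmbedding (boundedEmbedding P : ModG G → _) := by
  refine ⟨⟨le_antisymm (continuous_iff_le_induced.1 (continuous_iff_continuousAt.2 ?_))
    (le_generateFrom ?_)⟩, boundedEmbedding_injective h⟩
  · rintro (p | ω)
    · exact continuousAt_boundedEmbedding_point P p
    · exact continuousAt_boundedEmbedding_atEnd h ω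
  · intro A hA
    have key : ∀ x ∈ A, ∃ δ > 0, ∀ y,
        dist (boundedEmbedding P y) (boundedEmbedding P x) < δ → y ∈ A := by
      rcases hA with ⟨U, hU, rfl⟩ | ⟨X, ω, ε, hε, rfl⟩
      · rintro _ ⟨p, hp, rfl⟩
        obtain ⟨ε, hε, hεU⟩ := hU p hp
        obtain ⟨δ, hδ, hδ'⟩ := exists_nearby_of_dist_lt P p hε
        refine ⟨δ, hδ, fun y hy => ?_⟩
        obtain ⟨q, rfl, rfl | ⟨a, b, s, t, hab, hs, ht, hpc, hqc, hst⟩⟩ := hδ' y hy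
        · exact ⟨q, hp, rfl⟩
        · exact ⟨q, hεU q (lengthDist_lt_of_segment hε hab hs ht hpc hqc hst), rfl⟩
      · rintro (p | η) hx
        · obtain ⟨p₀, hp₀, hlt⟩ := (mem_basicNhd_point hε).1 hx
          obtain ⟨l, hl, hlε⟩ := (lengthDist_lt_iff hε).1 hlt
          obtain ⟨δ, hδ, hδ'⟩ := exists_nearby_of_dist_lt P p (sub_pos.2 hlε)
          refine ⟨δ, hδ, fun y hy => ?_⟩
          obtain ⟨q, rfl, rfl | ⟨a, b, s, t, hab, hs, ht, hpc, hqc, hst⟩⟩ := hδ' y hy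
          · exact hx
          · obtain ⟨l', hl', hle⟩ := exists_route_extend hab hs ht hpc hqc hl
            exact (mem_basicNhd_point hε).2
              ⟨p₀, hp₀, (lengthDist_lt_iff hε).2 ⟨l', hl', by linarith⟩⟩
        · rw [mem_basicNhd_atEnd] at hx
          obtain ⟨δ, hδ, hδ'⟩ := exists_mem_basicNhd_of_dist_lt h X η hε
          refine ⟨δ, hδ, fun y hy => ?_⟩
          have := hδ' y hy
          rwa [basicNhd, endsIn, hx] at this
    let _ : PseudoMetricSpace (ModG G) := PseudoMetricSpace.induced (boundedEmbedding P) inferInstance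
    exact Metric.isOpen_iff.2 key

theorem ParentMap.IsNormal.metrizableSpace (h : P.IsNormal G) :
    TopologicalSpace.MetrizableSpace (ModG G) :=
  (isEmbedding_boundedEmbedding h).metrizableSpace

end Metrizable

end GraphEnds

namespace GraphEnds

universe u
open SimpleGraph

/-! ### Walks within a set of vertices -/

section ConnectedWithin

variable {V : Type u} {G : SimpleGraph V} {A B : Set V} {a b c : V}

/-- Some walk from `a` to `b` uses vertices of `A` only. -/
def ConnectedWithin (G : SimpleGraph V) (A : Set V) (a b : V) : Prop :=
  ∃ W : G.Walk a b, ∀ x ∈ W.support, x ∈ A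

namespace ConnectedWithin

theorem refl (h : a ∈ A) : ConnectedWithin G A a a :=
  ⟨Walk.nil, fun x hx => by rw [Walk.support_nil, List.mem_singleton] at hx; exact hx ▸ h⟩

theorem symm (h : ConnectedWithin G A a b) : ConnectedWithin G A b a := by
  obtain ⟨W, hW⟩ := h
  exact ⟨W.reverse, fun x hx => hW x (by simpa using hx)⟩

theorem trans (h : ConnectedWithin G A a b) (h' : ConnectedWithin G A b c) :
    ConnectedWithin G A a c := by
  obtain ⟨W, hW⟩ := h
  obtain ⟨W', hW'⟩ := h'
  exact ⟨W.append W', fun x hx => ((Walk.mem_support_append_iff _ _).1 hx).elim (hW x) (hW' x)⟩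

theorem mono (h : ConnectedWithin G A a b) (hAB : A ⊆ B) : ConnectedWithin G B a b :=
  h.imp fun _ hW x hx => hAB (hW x hx)

theorem left_mem (h : ConnectedWithin G A a b) : a ∈ A :=
  h.elim fun W hW => hW _ W.start_mem_support

theorem right_mem (h : ConnectedWithin G A a b) : b ∈ A := h.symm.left_mem

theorem of_adj (hab : G.Adj a b) (ha : a ∈ A) (hb : b ∈ A) : ConnectedWithin G A a b :=
  ⟨Walk.cons hab Walk.nil, by simp [ha, hb]⟩

theorem of_walk (W : G.Walk a b) (hW : ∀ x ∈ W.support, x ∈ A) {x : V} (hx : x ∈ W.support) :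
    ConnectedWithin G A a x := by
  classical
  exact ⟨W.takeUntil x hx, fun y hy => hW y (W.support_takeUntil_subset_support hx hy)⟩

/-- A walk that leaves `A` has a first edge leaving `A`. -/
theorem exists_boundary (W : G.Walk a b) (ha : a ∈ A) (hb : b ∉ A) :
    ∃ c t, ConnectedWithin G A a c ∧ G.Adj t c ∧ t ∉ A ∧ t ∈ W.support := by
  induction W with
  | nil => exact absurd ha hb
  | cons h W ih =>
    rename_i x y z
    by_cases hy : y ∈ A
    · obtain ⟨c, t, h1, h2, h3, h4⟩ := ih hy hb
      exact ⟨c, t, (of_adj h ha hy).trans h1, h2, h3, List.mem_cons_of_mem _ h4⟩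
    · exact ⟨x, y, refl ha, h.symm, hy, List.mem_cons_of_mem _ W.start_mem_support⟩

end ConnectedWithin

theorem mem_component_of_connectedWithin {X : Finset V} {C : G.ComponentCompl (X : Set V)}
    (h : ConnectedWithin G (X : Set V)ᶜ a b) (ha : a ∈ (C : Set V)) : b ∈ (C : Set V) := by
  obtain ⟨W, hW⟩ := h
  obtain ⟨ha', rfl⟩ := ha
  exact ⟨hW _ W.end_mem_support,
    (componentComplMk_eq_of_walk W hW ha' (hW _ W.end_mem_support)).symm⟩

end ConnectedWithin

/-! ### Removing one vertex from each component at a time -/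

section Search

variable {V : Type u} {G : SimpleGraph V}

/-- In the decreasing sequence `A` of vertex sets, the vertex `v` is removed at stage `k`. -/
def RemovedAt (A : ℕ → Set V) (k : ℕ) (v : V) : Prop := v ∈ A k ∧ v ∉ A (k + 1)

/-- The vertex `t` is adjacent to the component of `v` in `G[A]`. -/
def Touches (G : SimpleGraph V) (A : Set V) (v t : V) : Prop :=
  ∃ c, ConnectedWithin G A v c ∧ G.Adj t c

/-- Among the vertices removed before stage `k` that have a neighbour in the component of `v` in
`G[A k]`, the vertex `t` is removed last. -/
def IsTop (G : SimpleGraph V) (A : ℕ → Set V) (k : ℕ) (v t : V) : Prop :=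
  ∃ i < k, RemovedAt A i t ∧ Touches G (A k) v t ∧
    ∀ j u, j < k → RemovedAt A j u → Touches G (A k) v u → j ≤ i

/-- A sequence of vertex sets arising from the set of all vertices by removing, at each stage `k`,
exactly one vertex `x` from each component of `G[A k]`. The vertex `x` is adjacent to the last
previously removed vertex adjacent to that component, and later stages remove all vertices of a walk
from `x` to a vertex of minimal rank in the component. -/
structure IsSearch (G : SimpleGraph V) (rank : V → ℕ) (A : ℕ → Set V) : Prop where
  zero : A 0 = Set.univ
  succ_subset : ∀ k, A (k + 1) ⊆ A k
  exists_removedAt : ∀ k, ∀ v ∈ A k, ∃ x, RemovedAt A k x ∧ ConnectedWithin G (A k) v x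
  unique : ∀ k x y, RemovedAt A k x → RemovedAt A k y → ConnectedWithin G (A k) x y → x = y
  adj_top : ∀ k x t, RemovedAt A k x → IsTop G A k x t → G.Adj t x
  exists_walk : ∀ k x, RemovedAt A k x → ∃ u, ConnectedWithin G (A k) x u ∧
    (∀ u', ConnectedWithin G (A k) x u' → rank u ≤ rank u') ∧
    ∃ W : G.Walk x u, ∀ y ∈ W.support, ∃ j, k ≤ j ∧ RemovedAt A j y

section Decreasing

variable {A : ℕ → Set V}

theorem subset_of_le_of_succ_subset (hA : ∀ k, A (k + 1) ⊆ A k) {j k : ℕ} (h : j ≤ k) :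
    A k ⊆ A j := by
  induction k, h using Nat.le_induction with
  | base => exact subset_rfl
  | succ k _ ih => exact (hA k).trans ih

theorem RemovedAt.stage_unique (hA : ∀ k, A (k + 1) ⊆ A k) {j k : ℕ} {v : V}
    (hj : RemovedAt A j v) (hk : RemovedAt A k v) : j = k := by
  rcases lt_trichotomy j k with h | h | h
  · exact absurd (subset_of_le_of_succ_subset hA h hk.1) hj.2
  · exact h
  · exact absurd (subset_of_le_of_succ_subset hA h hj.1) hk.2

theorem exists_removedAt_of_notMem (h0 : A 0 = Set.univ) {k : ℕ} {v : V} (hv : v ∉ A k) :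
    ∃ j < k, RemovedAt A j v := by
  induction k with
  | zero => exact absurd (h0 ▸ Set.mem_univ v) hv
  | succ k ih =>
    by_cases hk : v ∈ A k
    · exact ⟨k, Nat.lt_succ_self k, hk, hv⟩
    · obtain ⟨j, hj, h⟩ := ih hk
      exact ⟨j, by omega, h⟩

end Decreasing

theorem touches_congr {A : Set V} {v w t : V} (h : ConnectedWithin G A v w) :
    Touches G A v t ↔ Touches G A w t :=
  ⟨fun ⟨c, hc, ht⟩ => ⟨c, h.symm.trans hc, ht⟩, fun ⟨c, hc, ht⟩ => ⟨c, h.trans hc, ht⟩⟩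

theorem isTop_congr {A : ℕ → Set V} {k : ℕ} {v w : V} (h : ConnectedWithin G (A k) v w) (t : V) :
    IsTop G A k v t ↔ IsTop G A k w t := by
  simp only [IsTop, touches_congr h]

/-- There is at most one top vertex, as the removed vertices adjacent to a component of a later
stage have been in the same component when they were removed. -/
theorem IsTop.unique {A : ℕ → Set V} (hA : ∀ k, A (k + 1) ⊆ A k)
    (huniq : ∀ k x y, RemovedAt A k x → RemovedAt A k y → ConnectedWithin G (A k) x y → x = y)
    {k : ℕ} {v t t' : V} (h : IsTop G A k v t) (h' : IsTop G A k v t') : t = t' := by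
  obtain ⟨i, hi, ht, htv, hmax⟩ := h
  obtain ⟨j, hj, ht', htv', hmax'⟩ := h'
  obtain rfl : i = j := le_antisymm (hmax' i t hi ht htv) (hmax j t' hj ht' htv')
  obtain ⟨c, hc, htc⟩ := htv
  obtain ⟨c', hc', htc'⟩ := htv'
  have hsub := subset_of_le_of_succ_subset hA hi.le
  refine huniq i t t' ht ht' ?_
  exact ((ConnectedWithin.of_adj htc ht.1 (hsub hc.right_mem)).trans
    ((hc.symm.trans hc').mono hsub)).trans
    (ConnectedWithin.of_adj htc'.symm (hsub hc'.right_mem) ht'.1)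

/-- The property of the vertices `x` that may be removed at stage `k` from the component of `v`,
together with the length of a walk witnessing it. -/
def Candidate (G : SimpleGraph V) (rank : V → ℕ) (A : Set V) (T : V → Prop) (v : V) (l : ℕ)
    (x : V) : Prop :=
  ConnectedWithin G A v x ∧ (∀ t, T t → G.Adj t x) ∧ ∃ u, ConnectedWithin G A v u ∧
    (∀ u', ConnectedWithin G A v u' → rank u ≤ rank u') ∧
    ∃ W : G.Walk x u, (∀ y ∈ W.support, y ∈ A) ∧ W.length = l

/-- Vertices that occur as candidates with a walk of least length. -/
def BestCandidate (G : SimpleGraph V) (rank : V → ℕ) (A : Set V) (T : V → Prop) (v x : V) : Prop :=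
  ∃ l, Candidate G rank A T v l x ∧ ∀ l' x', Candidate G rank A T v l' x' → l ≤ l'

theorem exists_bestCandidate {rank : V → ℕ} {A : Set V} {T : V → Prop} {v : V}
    (h : ∃ l x, Candidate G rank A T v l x) : ∃ x, BestCandidate G rank A T v x := by
  classical
  obtain ⟨x, hx⟩ := Nat.find_spec h
  exact ⟨x, _, hx, fun l' x' h' => Nat.find_min' h ⟨x', h'⟩⟩

theorem bestCandidate_congr {rank : V → ℕ} {A : Set V} {T T' : V → Prop} {v w : V}
    (hT : ∀ t, T t ↔ T' t) (h : ConnectedWithin G A v w) :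
    BestCandidate G rank A T v = BestCandidate G rank A T' w := by
  obtain rfl : T = T' := funext fun t => propext (hT t)
  have hc : ∀ u, ConnectedWithin G A v u ↔ ConnectedWithin G A w u := fun u =>
    ⟨fun h' => h.symm.trans h', fun h' => h.trans h'⟩
  funext x
  simp only [BestCandidate, Candidate, hc]

open Classical in
/-- For each vertex, the number of stages before `k` that it has survived. A vertex `v` that has
survived all of them is removed at stage `k` if it is the one chosen among the best candidates in
its component. -/
noncomputable def age [Nonempty V] (G : SimpleGraph V) (rank : V → ℕ) : ℕ → V → ℕ
  | 0, _ => 0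
  | k + 1, v =>
    if age G rank k v = k ∧
      v ≠ Classical.epsilon (BestCandidate G rank {w | age G rank k w = k}
        (fun t => age G rank k t < k ∧ Touches G {w | age G rank k w = k} v t ∧
          ∀ u, age G rank k u < k → Touches G {w | age G rank k w = k} v u →
            age G rank k u ≤ age G rank k t) v)
    then k + 1 else age G rank k v

/-- The set of vertices that are not removed before stage `k`. -/
def remaining [Nonempty V] (G : SimpleGraph V) (rank : V → ℕ) (k : ℕ) : Set V :=
  {w | age G rank k w = k}

section Remaining

variable [Nonempty V] {rank : V → ℕ}

theorem age_le (k : ℕ) (v : V) : age G rank k v ≤ k := by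
  induction k with
  | zero => exact le_rfl
  | succ k ih =>
    rw [age]
    split_ifs
    · exact le_rfl
    · omega

theorem remaining_zero : remaining G rank 0 = Set.univ := Set.eq_univ_of_forall fun _ => rfl

theorem remaining_succ_subset (k : ℕ) : remaining G rank (k + 1) ⊆ remaining G rank k := by
  intro v hv
  have hv : age G rank (k + 1) v = k + 1 := hv
  rw [age] at hv
  split_ifs at hv with h
  · exact h.1
  · have := age_le (G := G) (rank := rank) k v
    omega

theorem age_eq_of_removedAt {j k : ℕ} {v : V} (h : RemovedAt (remaining G rank) j v)
    (hk : j < k) : age G rank k v = j := by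
  induction k, hk using Nat.le_induction with
  | base =>
    have h1 : age G rank j v = j := h.1
    have h2 : age G rank (j + 1) v ≠ j + 1 := h.2
    rw [age] at h2 ⊢
    split_ifs at h2 ⊢ with h3
    · exact absurd rfl h2
    · exact h1
  | succ k hk ih =>
    have hk : j < k := hk
    rw [age, if_neg (fun hh => by omega), ih]

theorem isTop_remaining_iff {k : ℕ} {v t : V} :
    (age G rank k t < k ∧ Touches G (remaining G rank k) v t ∧
      ∀ u, age G rank k u < k → Touches G (remaining G rank k) v u →
        age G rank k u ≤ age G rank k t) ↔ IsTop G (remaining G rank) k v t := by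
  have hex : ∀ u, age G rank k u < k → ∃ j < k, RemovedAt (remaining G rank) j u := fun u hu =>
    exists_removedAt_of_notMem remaining_zero (show ¬ (age G rank k u = k) by omega)
  constructor
  · rintro ⟨h1, h2, h3⟩
    obtain ⟨i, hi, ht⟩ := hex t h1
    refine ⟨i, hi, ht, h2, fun j u hj hu hut => ?_⟩
    have := h3 u (by rw [age_eq_of_removedAt hu hj]; exact hj) hut
    rwa [age_eq_of_removedAt hu hj, age_eq_of_removedAt ht hi] at this
  · rintro ⟨i, hi, ht, h2, h3⟩
    refine ⟨by rw [age_eq_of_removedAt ht hi]; exact hi, h2, fun u hu hut => ?_⟩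
    obtain ⟨j, hj, hu'⟩ := hex u hu
    rw [age_eq_of_removedAt hu' hj, age_eq_of_removedAt ht hi]
    exact h3 j u hj hu' hut

theorem removedAt_remaining_iff {k : ℕ} {v : V} : RemovedAt (remaining G rank) k v ↔
    v ∈ remaining G rank k ∧ v = Classical.epsilon (BestCandidate G rank (remaining G rank k)
      (IsTop G (remaining G rank) k v) v) := by
  rw [RemovedAt]
  refine and_congr_right fun hv => ?_
  have hT : IsTop G (remaining G rank) k v = _ := funext fun t => propext isTop_remaining_iff.symm
  change age G rank k v = k at hv
  rw [hT]
  change ¬ (age G rank (k + 1) v = k + 1) ↔ _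
  rw [age]
  split_ifs with h
  · exact ⟨fun hne => absurd rfl hne, fun heq => absurd heq h.2⟩
  · rw [not_and, not_not] at h
    exact ⟨fun _ => h hv, fun _ => by omega⟩

theorem removedAt_remaining_unique {k : ℕ} {x y : V} (hx : RemovedAt (remaining G rank) k x)
    (hy : RemovedAt (remaining G rank) k y) (h : ConnectedWithin G (remaining G rank k) x y) :
    x = y := by
  rw [removedAt_remaining_iff] at hx hy
  rw [hx.2, hy.2, bestCandidate_congr (isTop_congr h) h]

theorem exists_candidate {k : ℕ} {v : V} (hv : v ∈ remaining G rank k) :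
    ∃ l x, Candidate G rank (remaining G rank k) (IsTop G (remaining G rank) k v) v l x := by
  obtain ⟨x, hx, hxt⟩ : ∃ x, ConnectedWithin G (remaining G rank k) v x ∧
      ∀ t, IsTop G (remaining G rank) k v t → G.Adj t x := by
    by_cases h : ∃ t, IsTop G (remaining G rank) k v t
    · obtain ⟨t, ht⟩ := h
      obtain ⟨c, hc, htc⟩ := ht.choose_spec.2.2.1
      refine ⟨c, hc, fun t' ht' => ?_⟩
      rwa [ht'.unique remaining_succ_subset (fun _ _ _ => removedAt_remaining_unique) ht]
    · exact ⟨v, ConnectedWithin.refl hv, fun t ht => absurd ⟨t, ht⟩ h⟩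
  obtain ⟨u, hu, hmin⟩ := (measure rank).wf.has_min
    {u | ConnectedWithin G (remaining G rank k) v u} ⟨v, ConnectedWithin.refl hv⟩
  obtain ⟨W, hW⟩ := hx.symm.trans hu
  exact ⟨W.length, x, hx, hxt, u, hu, fun u' hu' => not_lt.1 (hmin u' hu'), W, hW, rfl⟩

theorem bestCandidate_of_removedAt {k : ℕ} {x : V} (h : RemovedAt (remaining G rank) k x) :
    BestCandidate G rank (remaining G rank k) (IsTop G (remaining G rank) k x) x x := by
  have h1 := Classical.epsilon_spec (exists_bestCandidate (exists_candidate h.1))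
  rwa [← (removedAt_remaining_iff.1 h).2] at h1

/-- Each removed vertex `x` is the start of a walk, removed entirely at its own or later stages, to
a vertex of minimal rank: if a shortest walk from `x` to such a vertex has a next vertex, that
vertex is a candidate of smaller length in its component at the following stage. -/
theorem exists_walk_removedAt (l : ℕ) : ∀ k x, RemovedAt (remaining G rank) k x →
    (∃ l' ≤ l, ∃ x', Candidate G rank (remaining G rank k) (IsTop G (remaining G rank) k x) x l' x')
    → ∃ u, ConnectedWithin G (remaining G rank k) x u ∧
      (∀ u', ConnectedWithin G (remaining G rank k) x u' → rank u ≤ rank u') ∧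
      ∃ W : G.Walk x u, ∀ y ∈ W.support, ∃ j, k ≤ j ∧ RemovedAt (remaining G rank) j y := by
  classical
  induction l with
  | zero =>
    rintro k x hx ⟨l', hl', x', hc⟩
    obtain ⟨l₀, ⟨-, -, u, hu, humin, W, -, hWl⟩, hl₀⟩ := bestCandidate_of_removedAt hx
    have : W.length = 0 := by have := hl₀ l' x' hc; omega
    obtain rfl := Walk.eq_of_length_eq_zero this
    refine ⟨x, hu, humin, Walk.nil, fun y hy => ⟨k, le_rfl, ?_⟩⟩
    rw [Walk.support_nil, List.mem_singleton] at hy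
    exact hy ▸ hx
  | succ l ih =>
    rintro k x hx ⟨l', hl', x', hc⟩
    obtain ⟨l₀, ⟨-, htop, u, hu, humin, W, hW, hWl⟩, hl₀⟩ := bestCandidate_of_removedAt hx
    have hle := hl₀ l' x' hc
    cases W with
    | nil =>
      refine ⟨x, hu, humin, Walk.nil, fun y hy => ⟨k, le_rfl, ?_⟩⟩
      rw [Walk.support_nil, List.mem_singleton] at hy
      exact hy ▸ hx
    | cons h W' =>
      rename_i b
      rw [Walk.length_cons] at hWl
      have hW' : ∀ y ∈ W'.support, y ∈ remaining G rank k := fun y hy =>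
        hW y (List.mem_cons_of_mem _ hy)
      have hconn : ∀ y ∈ W'.support, ConnectedWithin G (remaining G rank k) x y := fun y hy =>
        ConnectedWithin.of_walk _ hW (List.mem_cons_of_mem _ hy)
      -- By minimality, the rest of the walk does not return to `x`.
      have hxW : x ∉ W'.support := by
        intro hmem
        have h1 := hl₀ _ x ⟨ConnectedWithin.refl hx.1, htop, u, hu, humin, W'.dropUntil x hmem,
          fun y hy => hW' y (W'.support_dropUntil_subset_support hmem hy), rfl⟩
        have h2 := W'.length_dropUntil_le_length hmem
        omega
      have hnext : ∀ y ∈ W'.support, y ∈ remaining G rank (k + 1) := by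
        intro y hy
        by_contra hne
        exact hxW (removedAt_remaining_unique hx ⟨hW' y hy, hne⟩ (hconn y hy) ▸ hy)
      have hb := hnext b W'.start_mem_support
      have hsub : remaining G rank (k + 1) ⊆ remaining G rank k := remaining_succ_subset k
      have hxtop : IsTop G (remaining G rank) (k + 1) b x :=
        ⟨k, k.lt_succ_self, hx, ⟨b, ConnectedWithin.refl hb, h⟩, fun j _ hj _ _ => by omega⟩
      have htop' : ∀ t, IsTop G (remaining G rank) (k + 1) b t → t = x := fun t ht =>
        ht.unique remaining_succ_subset (fun _ _ _ => removedAt_remaining_unique) hxtop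
      have hxb : ConnectedWithin G (remaining G rank k) x b := hconn b W'.start_mem_support
      have hcand : Candidate G rank (remaining G rank (k + 1))
          (IsTop G (remaining G rank) (k + 1) b) b W'.length b :=
        ⟨ConnectedWithin.refl hb, fun t ht => htop' t ht ▸ h, u, ⟨W', hnext⟩,
          fun u' hu' => humin u' (hxb.trans (hu'.mono hsub)), W', hnext, rfl⟩
      obtain ⟨z, hz⟩ := exists_bestCandidate (exists_candidate hb)
      have hz := Classical.epsilon_spec ⟨z, hz⟩
      set y := Classical.epsilon (BestCandidate G rank (remaining G rank (k + 1))
        (IsTop G (remaining G rank) (k + 1) b) b) with hy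
      have hby : ConnectedWithin G (remaining G rank (k + 1)) b y := hz.choose_spec.1.1
      have hxy : G.Adj x y := hz.choose_spec.1.2.1 x hxtop
      have hyrem : RemovedAt (remaining G rank) (k + 1) y := by
        rw [removedAt_remaining_iff]
        refine ⟨hby.right_mem, hy.trans ?_⟩
        rw [bestCandidate_congr (isTop_congr hby) hby]
      obtain ⟨u₁, hu₁, hmin₁, W₁, hW₁⟩ := ih (k + 1) y hyrem ⟨W'.length, by omega, b, by
        obtain ⟨-, h2, u₂, h3, h4, h5⟩ := hcand
        exact ⟨hby.symm, fun t ht => h2 t ((isTop_congr hby t).2 ht), u₂, hby.symm.trans h3,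
          fun u' hu' => h4 u' (hby.trans hu'), h5⟩⟩
      have hxy' : ConnectedWithin G (remaining G rank k) x y := hxb.trans (hby.mono hsub)
      refine ⟨u₁, hxy'.trans (hu₁.mono hsub), fun u' hu' => ?_, Walk.cons hxy W₁, ?_⟩
      · exact (hmin₁ u (hby.symm.trans ⟨W', hnext⟩)).trans (humin u' hu')
      · intro w hw
        rw [Walk.support_cons, List.mem_cons] at hw
        rcases hw with rfl | hw
        · exact ⟨k, le_rfl, hx⟩
        · obtain ⟨j, hj, hj'⟩ := hW₁ w hw
          exact ⟨j, by omega, hj'⟩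

theorem isSearch_remaining (G : SimpleGraph V) (rank : V → ℕ) :
    IsSearch G rank (remaining G rank) where
  zero := remaining_zero
  succ_subset := remaining_succ_subset
  exists_removedAt := by
    intro k v hv
    have hbest := Classical.epsilon_spec (exists_bestCandidate (exists_candidate hv))
    have hconn := hbest.choose_spec.1.1
    refine ⟨_, removedAt_remaining_iff.2 ⟨hconn.right_mem, ?_⟩, hconn⟩
    rw [← bestCandidate_congr (isTop_congr hconn) hconn]
  unique := fun _ _ _ => removedAt_remaining_unique
  adj_top := fun _ _ t hx ht => (bestCandidate_of_removedAt hx).choose_spec.1.2.1 t ht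
  exists_walk := by
    intro k x hx
    obtain ⟨l, hl⟩ := bestCandidate_of_removedAt hx
    exact exists_walk_removedAt l k x hx ⟨l, le_rfl, x, hl.1⟩

end Remaining

end Search

end GraphEnds

namespace GraphEnds

universe u
open SimpleGraph

/-! ### Normal spanning trees from countably many dispersed sets -/

section SearchTree

variable {V : Type u} {G : SimpleGraph V} {rank : V → ℕ} {A : ℕ → Set V}

theorem IsSearch.subset (hS : IsSearch G rank A) {j k : ℕ} (h : j ≤ k) : A k ⊆ A j :=
  subset_of_le_of_succ_subset hS.succ_subset h

theorem IsSearch.exists_isTop (hG : G.Connected) (hS : IsSearch G rank A) {k : ℕ} (hk : 0 < k)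
    {v : V} (hv : v ∈ A k) : ∃ t, IsTop G A k v t := by
  classical
  obtain ⟨r, hr, -⟩ := hS.exists_removedAt 0 v (hS.zero ▸ Set.mem_univ v)
  obtain ⟨W⟩ := hG.preconnected v r
  obtain ⟨c, t, hc, htc, ht, -⟩ :=
    ConnectedWithin.exists_boundary W hv fun h => hr.2 (hS.subset hk h)
  obtain ⟨j, hj, hjt⟩ := exists_removedAt_of_notMem hS.zero ht
  obtain ⟨t', h1, h2, h3⟩ :=
    Nat.findGreatest_spec (P := fun i => ∃ t, i < k ∧ RemovedAt A i t ∧ Touches G (A k) v t)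
      hj.le ⟨t, hj, hjt, c, hc, htc⟩
  exact ⟨t', _, h1, h2, h3, fun i u hi hu hut => Nat.le_findGreatest hi.le ⟨u, hi, hu, hut⟩⟩

/-- The parent map `P` sends each vertex removed after stage `0` to the top vertex of its component
at that stage. -/
structure IsSearchTree (G : SimpleGraph V) (A : ℕ → Set V) (P : ParentMap V) : Prop where
  root : RemovedAt A 0 P.root
  eq_root : ∀ v, RemovedAt A 0 v → v = P.root
  isTop : ∀ k v, 0 < k → RemovedAt A k v → IsTop G A k v (P.parent v)

theorem IsSearch.exists_isSearchTree (hG : G.Connected) (hS : IsSearch G rank A) :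
    ∃ P : ParentMap V, IsSearchTree G A P := by
  classical
  obtain ⟨v₀⟩ := hG.nonempty
  obtain ⟨r, hr, -⟩ := hS.exists_removedAt 0 v₀ (hS.zero ▸ Set.mem_univ v₀)
  have stage_eq : ∀ {j k v}, RemovedAt A j v → RemovedAt A k v → j = k :=
    fun hj hk => hj.stage_unique hS.succ_subset hk
  let parent : V → V := fun v =>
    if h : ∃ t k, 0 < k ∧ RemovedAt A k v ∧ IsTop G A k v t then h.choose else r
  let stage : V → ℕ := fun v => if h : ∃ k, RemovedAt A k v then h.choose else 1
  have hstage : ∀ k v, RemovedAt A k v → stage v = k := by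
    intro k v hv
    have h : ∃ k, RemovedAt A k v := ⟨k, hv⟩
    simp only [stage, dif_pos h]
    exact stage_eq h.choose_spec hv
  have hpar : ∀ k v, 0 < k → RemovedAt A k v → IsTop G A k v (parent v) := by
    intro k v hk hv
    obtain ⟨t, ht⟩ := hS.exists_isTop hG hk hv.1
    have h : ∃ t k, 0 < k ∧ RemovedAt A k v ∧ IsTop G A k v t := ⟨t, k, hk, hv, ht⟩
    simp only [parent, dif_pos h]
    obtain ⟨k', -, hv', ht'⟩ := h.choose_spec
    exact stage_eq hv' hv ▸ ht'
  have heq : ∀ v, RemovedAt A 0 v → v = r := by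
    intro v hv
    obtain ⟨W⟩ := hG.preconnected v r
    exact hS.unique 0 v r hv hr ⟨W, fun x _ => hS.zero ▸ Set.mem_univ x⟩
  have hroot : parent r = r := by
    refine dif_neg ?_
    rintro ⟨t, k, hk, hrk, -⟩
    exact hk.ne (stage_eq hr hrk)
  obtain ⟨P, hPp, hPr⟩ := ParentMap.exists_of_rank parent r hroot stage (by
    intro v hv
    by_cases h : ∃ k, RemovedAt A k v
    · obtain ⟨k, hk⟩ := h
      have hk0 : 0 < k := Nat.pos_of_ne_zero fun h0 => hv (heq v (h0 ▸ hk))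
      obtain ⟨i, hi, hpi, -⟩ := hpar k v hk0 hk
      rwa [hstage _ _ hk, hstage _ _ hpi]
    · have h1 : parent v = r := dif_neg fun ⟨_, k, _, hk, _⟩ => h ⟨k, hk⟩
      have h2 : stage v = 1 := dif_neg h
      rw [h1, h2, hstage 0 r hr]
      exact zero_lt_one)
  exact ⟨P, hPr ▸ hr, hPr ▸ heq, hPp ▸ hpar⟩

variable {P : ParentMap V}

theorem IsSearchTree.exists_parent_removedAt (hP : IsSearchTree G A P) {k : ℕ} {v : V}
    (hv : RemovedAt A k v) : ∃ i ≤ k, RemovedAt A i (P.parent v) := by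
  rcases Nat.eq_zero_or_pos k with rfl | hk
  · refine ⟨0, le_rfl, ?_⟩
    rw [hP.eq_root v hv, P.parent_root]
    exact hP.root
  · obtain ⟨i, hi, h, -⟩ := hP.isTop k v hk hv
    exact ⟨i, hi.le, h⟩

theorem IsSearchTree.exists_removedAt_of_le (hP : IsSearchTree G A P) {k : ℕ} {u v : V}
    (huv : P.le u v) (hv : RemovedAt A k v) : ∃ i ≤ k, RemovedAt A i u := by
  obtain ⟨n, rfl⟩ := huv
  induction n with
  | zero => exact ⟨k, le_rfl, hv⟩
  | succ n ih =>
    obtain ⟨i, hi, h⟩ := ih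
    obtain ⟨j, hj, h'⟩ := hP.exists_parent_removedAt h
    exact ⟨j, hj.trans hi, by rwa [Function.iterate_succ_apply']⟩

theorem IsSearchTree.adj (hS : IsSearch G rank A) (hP : IsSearchTree G A P) {k : ℕ} {v : V}
    (hv : RemovedAt A k v) (hne : v ≠ P.root) : G.Adj (P.parent v) v := by
  have hk : 0 < k := Nat.pos_of_ne_zero fun h0 => hne (hP.eq_root v (h0 ▸ hv))
  exact hS.adj_top k v _ hv (hP.isTop k v hk hv)

/-- The removed vertices adjacent to a component of the remaining graph are all below the last one
of them in the tree-order, and hence form a chain. -/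
theorem IsSearchTree.le_top (hS : IsSearch G rank A) (hP : IsSearchTree G A P) {k : ℕ} :
    ∀ {v t u : V} {j : ℕ}, IsTop G A k v t → j < k → RemovedAt A j u → Touches G (A k) v u →
      P.le u t := by
  induction k using Nat.strong_induction_on with
  | _ k ih =>
    rintro v t u j ⟨i, hi, ht, ⟨c, hc, htc⟩, hmax⟩ hj hu ⟨d, hd, hud⟩
    have hsub : A k ⊆ A i := hS.subset hi.le
    have htd : ConnectedWithin G (A i) t d :=
      (ConnectedWithin.of_adj htc ht.1 (hsub hc.right_mem)).trans ((hc.symm.trans hd).mono hsub)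
    rcases eq_or_lt_of_le (hmax j u hj hu ⟨d, hd, hud⟩) with rfl | hji
    · rw [hS.unique j t u ht hu
        (htd.trans (ConnectedWithin.of_adj hud.symm htd.right_mem hu.1))]
      exact P.le_refl u
    · exact P.le_trans (ih i hi (hP.isTop i t (by omega) ht) hji hu ⟨d, htd, hud⟩) (P.parent_le t)

theorem IsSearchTree.le_of_touches (hS : IsSearch G rank A) (hP : IsSearchTree G A P) {j k : ℕ}
    {u v : V} (hjk : j < k) (hu : RemovedAt A j u) (hv : RemovedAt A k v)
    (h : Touches G (A k) v u) : P.le u v :=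
  P.le_trans (hP.le_top hS (hP.isTop k v (by omega) hv) hjk hu h) (P.parent_le v)

theorem IsSearchTree.comparable (hS : IsSearch G rank A) (hP : IsSearchTree G A P) {j k : ℕ}
    {u v : V} (hu : RemovedAt A j u) (hv : RemovedAt A k v) (huv : G.Adj u v) :
    P.le u v ∨ P.le v u := by
  rcases lt_trichotomy j k with h | rfl | h
  · exact Or.inl (hP.le_of_touches hS h hu hv ⟨v, ConnectedWithin.refl hv.1, huv⟩)
  · exact absurd (hS.unique j u v hu hv (ConnectedWithin.of_adj huv hu.1 hv.1)) huv.ne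
  · exact Or.inr (hP.le_of_touches hS h hv hu ⟨u, ConnectedWithin.refl hu.1, huv.symm⟩)

theorem IsSearchTree.isNormal (hS : IsSearch G rank A) (hP : IsSearchTree G A P)
    (hall : ∀ v, ∃ k, RemovedAt A k v) : P.IsNormal G where
  adj v hv := (hall v).elim fun _ hk => hP.adj hS hk hv
  comparable u v huv :=
    (hall u).elim fun _ hj => (hall v).elim fun _ hk => hP.comparable hS hj hk huv

section NeverRemoved

variable {v : V}

/-- The removed vertices adjacent to the component of `v` in the graph of the vertices that are
never removed. -/
def finalNeighbours (G : SimpleGraph V) (A : ℕ → Set V) (v : V) : Set V :=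
  {u | Touches G (⋂ k, A k) v u ∧ u ∉ ⋂ k, A k}

/-- If `v` is never removed, then vertices adjacent to its final component are removed at
arbitrarily late stages: otherwise its component at some stage would never change any more. -/
theorem IsSearch.exists_finalNeighbour (hS : IsSearch G rank A) (hv : v ∈ ⋂ k, A k) (K : ℕ) :
    ∃ k ≥ K, ∃ u ∈ finalNeighbours G A v, RemovedAt A k u := by
  obtain ⟨x, hx, W, hW⟩ := hS.exists_removedAt K v (Set.mem_iInter.1 hv K)
  obtain ⟨c, t, hc, htc, ht, htW⟩ :=
    ConnectedWithin.exists_boundary W hv fun h => hx.2 (Set.mem_iInter.1 h (K + 1))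
  obtain ⟨n, hn⟩ := not_forall.1 (fun h => ht (Set.mem_iInter.2 h))
  obtain ⟨k, -, hk⟩ := exists_removedAt_of_notMem hS.zero hn
  refine ⟨k, ?_, t, ⟨⟨c, hc, htc⟩, ht⟩, hk⟩
  by_contra hlt
  exact hk.2 (hS.subset (by omega) (hW t htW))

theorem exists_removedAt_of_mem_finalNeighbours (hS : IsSearch G rank A) {u : V}
    (hu : u ∈ finalNeighbours G A v) : ∃ k, RemovedAt A k u := by
  obtain ⟨n, hn⟩ := not_forall.1 (fun h => hu.2 (Set.mem_iInter.2 h))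
  obtain ⟨k, -, hk⟩ := exists_removedAt_of_notMem hS.zero hn
  exact ⟨k, hk⟩

theorem connectedWithin_of_mem_finalNeighbours {k : ℕ} {u : V}
    (hu : u ∈ finalNeighbours G A v) (hk : RemovedAt A k u) : ConnectedWithin G (A k) u v := by
  obtain ⟨⟨c, hc, huc⟩, -⟩ := hu
  have hc' := hc.mono (Set.iInter_subset A k)
  exact (ConnectedWithin.of_adj huc hk.1 hc'.right_mem).trans hc'.symm

theorem IsSearchTree.le_of_mem_finalNeighbours (hS : IsSearch G rank A) (hP : IsSearchTree G A P)
    {j k : ℕ} {u u' : V} (hu : u ∈ finalNeighbours G A v) (hu' : u' ∈ finalNeighbours G A v)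
    (hj : RemovedAt A j u) (hk : RemovedAt A k u') (hjk : j ≤ k) : P.le u u' := by
  rcases hjk.eq_or_lt with rfl | hlt
  · rw [hS.unique j u u' hj hk ((connectedWithin_of_mem_finalNeighbours hu hj).trans
      (connectedWithin_of_mem_finalNeighbours hu' hk).symm)]
    exact P.le_refl u'
  · obtain ⟨c, hc, huc⟩ := hu.1
    exact hP.le_of_touches hS hlt hj hk
      ⟨c, (connectedWithin_of_mem_finalNeighbours hu' hk).trans
        (hc.mono (Set.iInter_subset A k)), huc⟩

theorem IsSearchTree.le_total_finalNeighbours (hS : IsSearch G rank A) (hP : IsSearchTree G A P)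
    {u u' : V} (hu : u ∈ finalNeighbours G A v) (hu' : u' ∈ finalNeighbours G A v) :
    P.le u u' ∨ P.le u' u := by
  obtain ⟨j, hj⟩ := exists_removedAt_of_mem_finalNeighbours hS hu
  obtain ⟨k, hk⟩ := exists_removedAt_of_mem_finalNeighbours hS hu'
  exact (Nat.le_total j k).imp (hP.le_of_mem_finalNeighbours hS hu hu' hj hk)
    (hP.le_of_mem_finalNeighbours hS hu' hu hk hj)

theorem IsSearchTree.exists_finalNeighbour_depth (hS : IsSearch G rank A)
    (hP : IsSearchTree G A P) (hv : v ∈ ⋂ k, A k) (n : ℕ) :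
    ∃ u ∈ finalNeighbours G A v, n ≤ P.depth u := by
  induction n with
  | zero =>
    obtain ⟨_, _, u, hu, _⟩ := hS.exists_finalNeighbour hv 0
    exact ⟨u, hu, Nat.zero_le _⟩
  | succ n ih =>
    obtain ⟨u, hu, hn⟩ := ih
    obtain ⟨j, hj⟩ := exists_removedAt_of_mem_finalNeighbours hS hu
    obtain ⟨k, hk, u', hu', hk'⟩ := hS.exists_finalNeighbour hv (j + 1)
    refine ⟨u', hu', ?_⟩
    have hle := hP.le_of_mem_finalNeighbours hS hu hu' hj hk' (by omega)
    by_contra hlt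
    obtain rfl := P.eq_of_le_of_depth_le hle (by omega)
    have := hj.stage_unique hS.succ_subset hk'
    omega

/-- If `v` is never removed, the vertices adjacent to its final component lie on a ray of the search
tree starting at the root. -/
theorem IsSearchTree.exists_ray (hS : IsSearch G rank A) (hP : IsSearchTree G A P)
    (hv : v ∈ ⋂ k, A k) : ∃ R : Ray G,
      (∀ n, ∃ k, RemovedAt A k (R.vert n)) ∧ (∀ n, P.depth (R.vert n) = n) ∧
      ∀ n, ∀ u ∈ finalNeighbours G A v,
        (n ≤ P.depth u → P.le (R.vert n) u) ∧ (P.depth u ≤ n → P.le u (R.vert n)) := by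
  choose y hy hyd using hP.exists_finalNeighbour_depth hS hv
  choose R hRle hRd using fun n => P.exists_le_depth_eq (hyd n)
  have hrem : ∀ n, ∃ k, RemovedAt A k (R n) := fun n => by
    obtain ⟨k, hk⟩ := exists_removedAt_of_mem_finalNeighbours hS (hy n)
    exact (hP.exists_removedAt_of_le (hRle n) hk).imp fun _ h => h.2
  refine ⟨⟨R, fun m n hmn => by rw [← hRd m, ← hRd n, hmn], fun n => ?_⟩, hrem, hRd,
    fun n u hu => ?_⟩
  · have hne : R (n + 1) ≠ P.root := fun h0 => by
      have := hRd (n + 1)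
      rw [(P.depth_eq_zero _).2 h0] at this
      omega
    have hd := P.depth_parent _ hne
    rw [hRd] at hd
    obtain ⟨k, hk⟩ := hrem (n + 1)
    have hpar := hP.adj hS hk hne
    suffices h : R n = P.parent (R (n + 1)) by rwa [h]
    -- Both vertices have depth `n` and lie below a common final neighbour.
    have hcommon : ∃ z, P.le (R n) z ∧ P.le (P.parent (R (n + 1))) z := by
      have h1 := P.le_trans (P.parent_le (R (n + 1))) (hRle (n + 1))
      rcases hP.le_total_finalNeighbours hS (hy n) (hy (n + 1)) with h | h
      · exact ⟨_, P.le_trans (hRle n) h, h1⟩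
      · exact ⟨_, hRle n, P.le_trans h1 h⟩
    obtain ⟨z, h1, h2⟩ := hcommon
    refine P.eq_of_le_of_depth_le (P.le_of_le_of_depth_le h1 h2 ?_) ?_ <;> rw [hRd] <;> omega
  · rcases hP.le_total_finalNeighbours hS hu (hy n) with h | h
    · exact ⟨fun hn => P.le_of_le_of_depth_le (hRle n) h (by rw [hRd]; exact hn),
        fun hn => P.le_of_le_of_depth_le h (hRle n) (by rw [hRd]; exact hn)⟩
    · have h1 := P.le_trans (hRle n) h
      exact ⟨fun _ => h1,
        fun hn => P.le_of_le_of_depth_le (P.le_refl u) h1 (by rw [hRd]; exact hn)⟩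

/-- If `v` is never removed, then for some fixed rank there are arbitrarily late stages at which the
removed vertex is adjacent to the final component of `v` and starts a walk through vertices removed
even later to a vertex of that rank. -/
theorem IsSearch.exists_rank (hS : IsSearch G rank A) (hv : v ∈ ⋂ k, A k) :
    ∃ n, ∀ K, ∃ k ≥ K, ∃ x ∈ finalNeighbours G A v, RemovedAt A k x ∧ ∃ u, rank u = n ∧
      ∃ W : G.Walk x u, ∀ y ∈ W.support, ∃ j, k ≤ j ∧ RemovedAt A j y := by
  by_contra! hno
  choose K hK using hno
  obtain ⟨k, hk, x, hx, hkx⟩ :=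
    hS.exists_finalNeighbour hv ((Finset.range (rank v + 1)).sup K)
  obtain ⟨u, hu, hmin, W, hW⟩ := hS.exists_walk k x hkx
  have hle : rank u ≤ rank v := hmin v (connectedWithin_of_mem_finalNeighbours hx hkx)
  have hKk : K (rank u) ≤ k :=
    (Finset.le_sup (f := K) (Finset.mem_range.2 (Nat.lt_succ_of_le hle))).trans hk
  obtain ⟨y, hy, hy'⟩ := hK (rank u) k hKk x hx hkx u rfl W
  obtain ⟨j, hj, hj'⟩ := hW y hy
  exact hy' j hj hj'

end NeverRemoved

/-- If every set of vertices of a given rank is dispersed, that is, can be separated from every end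
by finitely many vertices, then the search removes every vertex: a vertex that is never removed
yields a ray of the search tree with infinitely many connections, leaving every finite set, to
vertices of one rank. -/
theorem IsSearchTree.exists_removedAt (hS : IsSearch G rank A) (hP : IsSearchTree G A P)
    (hrank : ∀ n (ω : Ends G), ∃ X : Finset V, ∀ v ∈ (component X ω : Set V), rank v ≠ n) (v : V) :
    ∃ k, RemovedAt A k v := by
  by_contra hnever
  have hv : v ∈ ⋂ k, A k := by
    rw [Set.mem_iInter]
    intro k
    by_contra hk
    obtain ⟨j, -, hj⟩ := exists_removedAt_of_notMem hS.zero hk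
    exact hnever ⟨j, hj⟩
  obtain ⟨R, hRrem, hRd, hR⟩ := hP.exists_ray hS hv
  obtain ⟨n, hn⟩ := hS.exists_rank hv
  obtain ⟨X, hX⟩ := hrank n R.toEnd
  -- The finitely many vertices of `X` that are removed at all are removed before some stage `K`.
  obtain ⟨K, hK⟩ : ∃ K, ∀ x ∈ X, ∀ j, RemovedAt A j x → j < K := by
    classical
    let stage : V → ℕ := fun x => if h : ∃ j, RemovedAt A j x then h.choose else 0
    refine ⟨X.sup stage + 1, fun x hx j hj => ?_⟩
    have h : ∃ j, RemovedAt A j x := ⟨j, hj⟩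
    have h1 : stage x = j := (dif_pos h).trans (h.choose_spec.stage_unique hS.succ_subset hj)
    have h2 := Finset.le_sup (f := stage) hx
    omega
  obtain ⟨k, hk, x, hx, hkx, u, hu, W, hW⟩ := hn K
  have hxu : ConnectedWithin G (X : Set V)ᶜ x u := by
    refine ⟨W, fun y hy hyX => ?_⟩
    obtain ⟨j, hj, hj'⟩ := hW y hy
    have := hK y hyX j hj'
    omega
  have htail : ∀ m, P.depth x ≤ m → R.vert m ∈ (X : Set V)ᶜ := by
    intro m hm hmX
    obtain ⟨j, hj⟩ := hRrem m
    obtain ⟨i, hi, hi'⟩ := hP.exists_removedAt_of_le ((hR m x hx).2 hm) hj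
    have h1 := hi'.stage_unique hS.succ_subset hkx
    have h2 := hK _ hmX j hj
    omega
  have hxR : x = R.vert (P.depth x) :=
    P.eq_of_le_of_depth_le ((hR _ x hx).2 le_rfl) (by rw [hRd])
  have hray : ∀ m, P.depth x ≤ m → ConnectedWithin G (X : Set V)ᶜ (R.vert m) x := by
    intro m hm
    induction m, hm using Nat.le_induction with
    | base => rw [← hxR]; exact ConnectedWithin.refl hxu.left_mem
    | succ m hm ih =>
      exact (ConnectedWithin.of_adj (R.adj m).symm (htail _ (by omega)) (htail _ hm)).trans ih
  obtain ⟨N, hN⟩ := component_spec (X := X) (R := R) rfl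
  exact hX u (mem_component_of_connectedWithin
    ((hray _ (le_max_left (P.depth x) N)).trans hxu) (hN _ (le_max_right _ _))) hu

/-- A connected graph whose vertex set is a countable union of dispersed sets has a normal spanning
tree. -/
theorem exists_isNormal_of_rank (hG : G.Connected) (rank : V → ℕ)
    (hrank : ∀ n (ω : Ends G), ∃ X : Finset V, ∀ v ∈ (component X ω : Set V), rank v ≠ n) :
    ∃ P : ParentMap V, P.IsNormal G := by
  have := hG.nonempty
  have hS := isSearch_remaining G rank
  obtain ⟨P, hP⟩ := hS.exists_isSearchTree hG
  exact ⟨P, hP.isNormal hS (hP.exists_removedAt hS hrank)⟩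

end SearchTree

/-! ### Dispersed sets from a metric -/

section Metric

variable {V : Type u} {G : SimpleGraph V}

theorem component_subset_of_subset {X Y : Finset V} (h : X ⊆ Y) (ω : Ends G) :
    (component Y ω : Set V) ⊆ (component X ω : Set V) := by
  obtain ⟨R, hR⟩ := exists_toEnd_eq ω
  obtain ⟨v, hvY, hvX⟩ := (component_spec (X := Y) hR).exists_mem (component_spec (X := X) hR)
  rintro x ⟨hx, hxC⟩
  obtain ⟨hv, hvC⟩ := hvY
  obtain ⟨W⟩ := ConnectedComponent.exact (hvC.trans hxC.symm)
  have key : ∀ y ∈ (W.map (Embedding.induce _).toHom).support, y ∈ (X : Set V)ᶜ := by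
    intro y hy hyX
    rw [Walk.support_map, List.mem_map] at hy
    obtain ⟨z, -, rfl⟩ := hy
    exact z.2 (h hyX)
  exact mem_component_of_connectedWithin ⟨W.map (Embedding.induce _).toHom, key⟩ hvX

/-- An open set around an end contains all vertices of one of the components in which the end
lives. -/
theorem exists_component_subset_of_isOpen {O : Set (ModG G)} (hO : IsOpen O) :
    ∀ ω, ModG.atEnd ω ∈ O → ∃ X : Finset V, ∀ v ∈ (component X ω : Set V),
      ModG.point (Point.ofVertex G v) ∈ O := by
  classical
  induction hO with
  | basic s hs =>
    rcases hs with ⟨U, hU, rfl⟩ | ⟨X, η, ε, hε, rfl⟩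
    · rintro ω ⟨p, -, hp⟩
      cases hp
    · intro ω hω
      rw [mem_basicNhd_atEnd] at hω
      refine ⟨X, fun v hv => (mem_basicNhd_point hε).2
        ⟨Point.ofVertex G v, fun x hx => ?_, lengthDist_self_lt _ hε⟩⟩
      have hxv : x = v := by
        by_contra hne
        exact hx (Point.coord_ofVertex_ne hne)
      rw [hxv, ← hω]
      exact hv
  | univ => exact fun ω _ => ⟨∅, fun v _ => Set.mem_univ _⟩
  | inter s t _ _ ihs iht =>
    rintro ω ⟨hs, ht⟩
    obtain ⟨X, hX⟩ := ihs ω hs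
    obtain ⟨Y, hY⟩ := iht ω ht
    exact ⟨X ∪ Y, fun v hv =>
      ⟨hX v (component_subset_of_subset Finset.subset_union_left ω hv),
        hY v (component_subset_of_subset Finset.subset_union_right ω hv)⟩⟩
  | sUnion S _ ih =>
    rintro ω ⟨s, hs, hω⟩
    obtain ⟨X, hX⟩ := ih s hs ω hω
    exact ⟨X, fun v hv => ⟨s, hs, hX v hv⟩⟩

/-- A vertex has a neighbourhood in `|G|` without ends: the open star around it. -/
theorem isOpen_star (G : SimpleGraph V) (v : V) :
    IsOpen (ModG.point '' {q : Point G | 0 < q.coord v}) := by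
  refine TopologicalSpace.isOpen_generateFrom_of_mem (Or.inl ⟨_, fun p hp => ?_, rfl⟩)
  refine ⟨p.coord v, hp, fun q hq => ?_⟩
  have := (abs_lt.1 (abs_coord_sub_lt hp hq v)).2
  change 0 < q.coord v
  linarith

/-- If the subspace of vertices and ends is metrizable, rank a vertex by its distance from the set
of ends. Vertices of a fixed rank then have distance bounded below from each end, and so they are
separated from it by finitely many vertices. -/
theorem exists_dispersed_rank [TopologicalSpace.MetrizableSpace (vHat G)] :
    ∃ rank : V → ℕ, ∀ n (ω : Ends G),
      ∃ X : Finset V, ∀ v ∈ (component X ω : Set V), rank v ≠ n := by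
  let _ : MetricSpace (vHat G) := TopologicalSpace.metrizableSpaceMetric (vHat G)
  let vtx : V → vHat G := fun v => ⟨ModG.point (Point.ofVertex G v), Or.inl ⟨v, rfl⟩⟩
  let atEnd : Ends G → vHat G := fun ω => ⟨ModG.atEnd ω, Or.inr ⟨ω, rfl⟩⟩
  have hex : ∀ v, ∃ n : ℕ, ∀ ω, 1 / ((n : ℝ) + 1) ≤ Dist.dist (vtx v) (atEnd ω) := by
    intro v
    have hstar : vtx v ∈ Subtype.val ⁻¹' (ModG.point '' {q : Point G | 0 < q.coord v}) :=
      ⟨Point.ofVertex G v, by simp [Point.coord_ofVertex_self], rfl⟩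
    obtain ⟨ε, hε, hball⟩ := Metric.isOpen_iff.1
      ((isOpen_star G v).preimage continuous_subtype_val) (vtx v) hstar
    obtain ⟨n, hn⟩ := exists_nat_one_div_lt hε
    refine ⟨n, fun ω => ?_⟩
    by_contra! hlt
    obtain ⟨q, -, hq⟩ := hball (show atEnd ω ∈ Metric.ball (vtx v) ε by
      rw [Metric.mem_ball']; exact hlt.trans hn)
    cases hq
  choose rank hrank using hex
  refine ⟨rank, fun n ω => ?_⟩
  obtain ⟨O, hO, hOball⟩ := isOpen_induced_iff.1
    (Metric.isOpen_ball (x := atEnd ω) (ε := 1 / ((n : ℝ) + 1)))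
  have hωO : atEnd ω ∈ Subtype.val ⁻¹' O := by
    rw [hOball]
    exact Metric.mem_ball_self Nat.one_div_pos_of_nat
  obtain ⟨X, hX⟩ := exists_component_subset_of_isOpen hO ω hωO
  refine ⟨X, fun v hv hvn => ?_⟩
  have hvO : vtx v ∈ Subtype.val ⁻¹' O := hX v hv
  rw [hOball, Metric.mem_ball] at hvO
  exact absurd (hvn ▸ hrank v ω) (not_le.2 hvO)

end Metric

end GraphEnds

theorem mainTheorem6 {V : Type*} (G : SimpleGraph V) (hG : G.Connected) :
    List.TFAE
      [TopologicalSpace.MetrizableSpace (GraphEnds.ModG G),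
       TopologicalSpace.MetrizableSpace (GraphEnds.vHat G),
       GraphEnds.HasNormalSpanningTree G] := by
  tfae_have 1 → 2 := fun _ => inferInstance
  tfae_have 2 → 3 := by
    intro _
    obtain ⟨rank, hrank⟩ := GraphEnds.exists_dispersed_rank (G := G)
    obtain ⟨P, hP⟩ := GraphEnds.exists_isNormal_of_rank hG rank hrank
    exact hP.hasNormalSpanningTree
  tfae_have 3 → 1 := by
    intro h
    obtain ⟨P, hP⟩ := h.exists_isNormal
    exact hP.metrizableSpace
  tfae_finish
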